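/- For $j\in\{1,2,3\}$ let $S_j(x)=\frac15x+\frac25(j-1)$, $x\in\mathbb R$, and let $P$ be the standard triadic Cantor distribution, i.e. the Borel probability measure on $\mathbb R$ with $P=\frac13\sum_{j=1}^3P\circ S_j^{-1}$. For a word $\sigma=\sigma_1\cdots\sigma_k\in\{1,2,3\}^k$ put $S_\sigma=S_{\sigma_1}\circ\cdots\circ S_{\sigma_k}$ and $J_\sigma=S_\sigma([0,1])$, and for words $\beta,\dots,\delta$ put $$a(\beta,\dots,\delta)=\frac{1}{P(J_\beta\cup\cdots\cup J_\delta)}\int_{J_\beta\cup\cdots\cup J_\delta}x\,dP(x).$$ For a finite nonempty set $\alpha\subset\mathbb R$ let $V(P;\alpha)=\int\min_{a\in\alpha}(x-a)^2\,dP(x)$, and let $V_n=\inf\{V(P;\alpha):\emptyset\ne\alpha\subset\mathbb R,\ \mathrm{card}(\alpha)\le n\}$; an optimal set of $n$-means is a nonempty set $\alpha$ with $\mathrm{card}(\alpha)\le n$ and $V(P;\alpha)=V_n$. Let $\alpha_2=\{a(1,21),a(22,23,3)\}$ and $\alpha_3=\{a(1),a(2),a(3)\}$. The measure $P$ has finite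 second moment; its variance is $V=\frac19$, and $V(P;\alpha_2)=\frac{821}{28125}$, $V(P;\alpha_3)=\frac1{225}$. Moreover, let $n\ge3$, let $\ell=\ell(n)$ be the natural number with $3^{\ell}\le n<3^{\ell+1}$, and let $I\subset\{1,2,3\}^{\ell}$. (i) If $3^\ell\le n\le2\cdot3^\ell$ and $\mathrm{card}(I)=n-3^\ell$, then $$\alpha_n(I)=\{a(\omega):\omega\in\{1,2,3\}^\ell\setminus I\}\cup\bigcup_{\omega\in I}S_\omega(\alpha_2)$$ is an optimal set of $n$-means for $P$, and $$V_n=V(P;\alpha_n(I))=\frac1{75^\ell}\Big((2\cdot3^\ell-n)V+(n-3^\ell)V(P;\alpha_2)\Big).$$ (ii) If $2\cdot3^\ell<n<3^{\ell+1}$ and $\mathrm{card}(I)=n-2\cdot3^\ell$, then $$\alpha_n(I)=\bigcup_{\omega\in\{1,2,3\}^\ell\setminus I}S_\omega(\alpha_2)\cup\bigcup_{\omega\in I}S_\omega(\alpha_3)$$ is an optimal set of $n$-means for $P$, and $$V_n=V(P;\alpha_n(I))=\frac1{75^\ell}\Big((3^{\ell+1}-n)V(P;\alpha_2)+(n-2\cdot3^\ell)V(P;\alpha_3)\Big).$$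 -/

import Mathlib

open MeasureTheory

noncomputable section

namespace TriadicCantor

/-- The similarities of the real line with ratio `1/5`. The letters `1, 2, 3` are represented by
`0, 1, 2 : Fin 3`, so that the `j`-th map is `x ↦ x / 5 + 2 * j / 5` with `j = 0, 1, 2`. -/
def S (j : Fin 3) (x : ℝ) : ℝ := x / 5 + 2 * ((j : ℕ) : ℝ) / 5

/-- `P = (1/3) ∑ P ∘ S_j⁻¹`. -/
def IsSelfSimilar (P : Measure ℝ) : Prop :=
  P = (3 : ENNReal)⁻¹ • ∑ j : Fin 3, P.map (S j)

/-- `S_σ = S_{σ₁} ∘ ⋯ ∘ S_{σₙ}` for a finite word `σ`; the identity for the empty word. -/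
def Sw : List (Fin 3) → ℝ → ℝ
  | [], x => x
  | j :: σ, x => S j (Sw σ x)

/-- `J_σ = S_σ([0, 1])`. -/
def J (σ : List (Fin 3)) : Set ℝ := Sw σ '' Set.Icc 0 1

/-- `J_β ∪ J_γ ∪ ⋯ ∪ J_δ` for a list of words `β, γ, …, δ`. -/
def JU (L : List (List (Fin 3))) : Set ℝ := ⋃ σ ∈ L, J σ

/-- `a(β, γ, …, δ) = E(X | X ∈ J_β ∪ J_γ ∪ ⋯ ∪ J_δ)` for `X` with distribution `P`. -/
def centroid (P : Measure ℝ) (L : List (List (Fin 3))) : ℝ :=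
  (P.real (JU L))⁻¹ * ∫ x in JU L, x ∂P

/-- `{a(1, 21), a(22, 23, 3)}`. -/
def alpha2 (P : Measure ℝ) : Finset ℝ :=
  {centroid P [[0], [1, 0]], centroid P [[1, 1], [1, 2], [2]]}

/-- `{a(1), a(2), a(3)}`. -/
def alpha3 (P : Measure ℝ) : Finset ℝ :=
  {centroid P [[0]], centroid P [[1]], centroid P [[2]]}

/-- The set `α_n(I)`; here `l` is the number with `3 ^ l ≤ n < 3 ^ (l + 1)`, and `I` is a set of
words of length `l`. -/
def alphaSet (P : Measure ℝ) (l n : ℕ) (I : Finset (Fin l → Fin 3)) : Finset ℝ :=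
  if n ≤ 2 * 3 ^ l then
    (Iᶜ).image (fun ω => centroid P [List.ofFn ω]) ∪
      I.biUnion (fun ω => (alpha2 P).image (Sw (List.ofFn ω)))
  else
    (Iᶜ).biUnion (fun ω => (alpha2 P).image (Sw (List.ofFn ω))) ∪
      I.biUnion (fun ω => (alpha3 P).image (Sw (List.ofFn ω)))

/-- The distortion error `V(P; α) = ∫ min_{a ∈ α} (x - a)² dP(x)` of a finite nonempty set `α`. -/
def distortion (P : Measure ℝ) (α : Finset ℝ) : ℝ :=
  ∫ x, (⨅ a : α, (x - (a : ℝ)) ^ 2) ∂P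

/-- The `n`-th quantization error, the infimum of `V(P; α)` over the nonempty finite sets `α`
with at most `n` points. -/
def quantError (P : Measure ℝ) (n : ℕ) : ℝ :=
  sInf {v : ℝ | ∃ α : Finset ℝ, α.Nonempty ∧ α.card ≤ n ∧ v = distortion P α}

/-- `α` is an optimal set of `n`-means for `P`. -/
def IsOptimal (P : Measure ℝ) (n : ℕ) (α : Finset ℝ) : Prop :=
  α.Nonempty ∧ α.card ≤ n ∧ distortion P α = quantError P n

/-- The Borel probability measure in question exists. -/
theorem exists_isSelfSimilar : ∃ P : Measure ℝ, IsProbabilityMeasure P ∧ IsSelfSimilar P := by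
  classical
  let μ : Measure (Fin 3) := (3 : ENNReal)⁻¹ • Measure.count
  have hμ : IsProbabilityMeasure μ := ⟨by
    simp only [μ, Measure.smul_apply, smul_eq_mul, Measure.count_univ]
    simp [ENNReal.inv_mul_cancel]⟩
  let ν : Measure (ℕ → Fin 3) := Measure.infinitePi fun _ => μ
  let c : Fin 3 × (ℕ → Fin 3) → ℕ → Fin 3 := fun p n => Nat.casesOn n p.1 p.2
  have hc : Measurable c := by
    refine measurable_pi_lambda _ fun n => ?_
    cases n with
    | zero => exact measurable_fst
    | succ n => exact (measurable_pi_apply n).comp measurable_snd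
  have hν : (μ.prod ν).map c = ν := by
    refine Measure.eq_infinitePi _ fun s t ht => ?_
    rw [Measure.map_apply hc (MeasurableSet.pi s.countable_toSet fun i _ => ht i)]
    have : c ⁻¹' (Set.pi s t) = (if 0 ∈ s then t 0 else Set.univ) ×ˢ
        Set.pi (s.preimage Nat.succ Nat.succ_injective.injOn : Finset ℕ) (fun i => t (i + 1)) := by
      ext p
      simp only [Set.mem_preimage, Set.mem_pi, Set.mem_prod, Finset.coe_preimage,
        Finset.mem_coe]
      constructor
      · intro h
        refine ⟨?_, fun i hi => h (i + 1) hi⟩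
        split_ifs with h0
        · exact h 0 h0
        · trivial
      · rintro ⟨h0, h1⟩ i hi
        cases i with
        | zero => rw [if_pos hi] at h0; exact h0
        | succ i => exact h1 i hi
    rw [this, Measure.prod_prod, Measure.infinitePi_pi _ (fun i _ => ht _),
      Finset.prod_preimage' Nat.succ s Nat.succ_injective.injOn (fun i => μ (t i))]
    have hr : s.filter (fun x => x ∈ Set.range Nat.succ) = s.erase 0 := by
      ext x
      simp only [Finset.mem_filter, Finset.mem_erase, Nat.range_succ, Set.mem_ofPred_eq]
      exact ⟨fun h => ⟨h.2.ne', h.1⟩, fun h => ⟨h.2, Nat.pos_of_ne_zero h.1⟩⟩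
    rw [hr]
    split_ifs with h0
    · exact Finset.mul_prod_erase s (fun i => μ (t i)) h0
    · rw [measure_univ, one_mul, Finset.erase_eq_of_notMem h0]
  let X : (ℕ → Fin 3) → ℝ := fun d => ∑' i, (2 * ((d i : ℕ) : ℝ) / 5) * (1 / 5) ^ i
  have hs : ∀ d : ℕ → Fin 3, Summable fun i => (2 * ((d i : ℕ) : ℝ) / 5) * (1 / 5) ^ i := by
    intro d
    refine Summable.of_nonneg_of_le (fun i => by positivity) (fun i => ?_)
      (summable_geometric_of_lt_one (r := (1 / 5 : ℝ)) (by norm_num) (by norm_num))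
    have : ((d i : ℕ) : ℝ) ≤ 2 := by exact_mod_cast Nat.le_of_lt_succ (d i).isLt
    exact mul_le_of_le_one_left (by positivity) (by linarith)
  have hX : Measurable X := by
    refine Measurable.tsum (fun i => ?_)
    exact (measurable_of_countable fun j : Fin 3 =>
      (2 * ((j : ℕ) : ℝ) / 5) * (1 / 5) ^ i).comp (measurable_pi_apply i)
  have hXc : ∀ p, X (c p) = S p.1 (X p.2) := by
    intro p
    simp only [X]
    rw [(hs (c p)).tsum_eq_zero_add]
    have : ∀ i, (2 * ((c p (i + 1) : ℕ) : ℝ) / 5) * (1 / 5) ^ (i + 1) =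
        (2 * ((p.2 i : ℕ) : ℝ) / 5) * (1 / 5) ^ i * (1 / 5) := fun i => by
      rw [pow_succ, ← mul_assoc]
    simp only [this]
    rw [tsum_mul_right]
    have h0 : c p 0 = p.1 := rfl
    rw [h0, S, pow_zero, mul_one]
    ring
  have hS : ∀ j, Measurable (S j) := fun j => by unfold S; fun_prop
  refine ⟨ν.map X, Measure.isProbabilityMeasure_map hX.aemeasurable, ?_⟩
  unfold IsSelfSimilar
  ext A hA
  have h1 : ν.map X A = (μ.prod ν) {p | S p.1 (X p.2) ∈ A} := by
    conv_lhs => rw [← hν]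
    rw [Measure.map_map hX hc, Measure.map_apply (hX.comp hc) hA]
    congr 1
    ext p
    simp [hXc]
  have hm : MeasurableSet {p : Fin 3 × (ℕ → Fin 3) | S p.1 (X p.2) ∈ A} := by
    have : Measurable fun p : Fin 3 × (ℕ → Fin 3) => S p.1 (X p.2) :=
      measurable_from_prod_countable_right fun j => (hS j).comp hX
    exact this hA
  rw [h1, Measure.prod_apply hm]
  simp only [μ, lintegral_smul_measure, lintegral_count, tsum_fintype, Measure.smul_apply,
    Measure.finsetSum_apply]
  congr 1
  refine Finset.sum_congr rfl fun j _ => ?_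
  rw [Measure.map_map (hS j) hX, Measure.map_apply ((hS j).comp hX) hA]
  rfl

end TriadicCantor

end

open TriadicCantor

namespace TriadicCantor

/-! ### The measure -/

/-! Write E for `optError`: E(1) = 1/9, E(2) = 821/28125, and for n ≥ 3 the value 75 E(n) is the sum
of E over the most even splitting of n into three parts. Unwinding the recursion gives the two
affine formulas of the theorem. It remains to show that E(card α) ≤ V(P; α) for every nonempty α
(`optError_card_le`) and that α_n(I) attains E(n); the latter follows by serving each cylinder with
its own points.

The lower bound is an induction on card α. By self-similarity 75 V(P; α) is the sum of the
distortions of the rescaled sets S_i⁻¹(α). Each point is attributed to one piece, with cuts in the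
middle of the gaps, so that after rescaling to piece i the foreign points lie in (-∞, -1/2] ∪ [3/2,
∞). If foreign points never helped, piece i with m_i points of its own would cost at least E(m_i),
and the convexity of E (`optError_add_le`) would conclude.

Foreign points can push the cost of a piece below E(m_i) only when m_i = 1, by at most 1/288, and
only if some foreign point lies within 1/8 of the cut (`distortion_one`). That point is badly placed
for its own piece. If this piece owns at most two points, it pays a surplus 1/125 > 2/288
(`optError_add_le_of_near`). If it owns at least three, the splitting is so uneven that convexity
leaves a slack 1/20 > 3/288 (`optError_sum_add_le`). A piece owning no point is too expensive once n
≥ 3.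

The two-point case is a direct estimate according to the position of the midpoint
(`distortion_pair`). The reflection x ↦ 1 - x halves the case distinctions. -/

theorem continuous_S (j : Fin 3) : Continuous (S j) := by unfold S; fun_prop

theorem measurable_S (j : Fin 3) : Measurable (S j) := (continuous_S j).measurable

theorem S_zero (x : ℝ) : S 0 x = x / 5 := by simp [S]
theorem S_one (x : ℝ) : S 1 x = x / 5 + 2 / 5 := by simp [S]
theorem S_two (x : ℝ) : S 2 x = x / 5 + 4 / 5 := by simp [S]; norm_num

theorem val_le_two (j : Fin 3) : ((j : ℕ) : ℝ) ≤ 2 := by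
  exact_mod_cast Nat.le_of_lt_succ j.isLt

theorem IsSelfSimilar.apply {P : Measure ℝ} (hP : IsSelfSimilar P) {A : Set ℝ}
    (hA : MeasurableSet A) :
    P A = 3⁻¹ * (P (S 0 ⁻¹' A) + P (S 1 ⁻¹' A) + P (S 2 ⁻¹' A)) := by
  conv_lhs => rw [hP]
  simp [Fin.sum_univ_three, Measure.map_apply (measurable_S _) hA, mul_add]

theorem abs_sub_half_of_S {j : Fin 3} {x t : ℝ} (h : 1 / 2 + t < |S j x - 1 / 2|) :
    1 / 2 + 5 * t < |x - 1 / 2| := by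
  have h0 : (0 : ℝ) ≤ ((j : ℕ) : ℝ) := by positivity
  have h2 := val_le_two j
  unfold S at h
  rcases lt_abs.1 h with h | h
  · exact lt_abs.2 (Or.inl (by linarith))
  · exact lt_abs.2 (Or.inr (by linarith))

/-- Each S_j maps [0,1] into itself and contracts by 5, so a point whose image lies beyond [0,1] by
more than t lies beyond it by more than 5t. Iteration pushes the tail to infinity and confines P to
[0,1]. -/
theorem IsSelfSimilar.measure_tail_le {P : Measure ℝ} (hP : IsSelfSimilar P) (t : ℝ) :
    P {x | 1 / 2 + t < |x - 1 / 2|} ≤ P {x | 1 / 2 + 5 * t < |x - 1 / 2|} := by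
  have hm : MeasurableSet {x : ℝ | 1 / 2 + t < |x - 1 / 2|} :=
    measurableSet_lt measurable_const (by fun_prop)
  have h (j : Fin 3) : P (S j ⁻¹' {x | 1 / 2 + t < |x - 1 / 2|}) ≤
      P {x | 1 / 2 + 5 * t < |x - 1 / 2|} :=
    measure_mono fun x hx => abs_sub_half_of_S (j := j) hx
  rw [hP.apply hm]
  calc _ ≤ (3 : ENNReal)⁻¹ * (P {x | 1 / 2 + 5 * t < |x - 1 / 2|} +
        P {x | 1 / 2 + 5 * t < |x - 1 / 2|} + P {x | 1 / 2 + 5 * t < |x - 1 / 2|}) := by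
        exact mul_le_mul_right (add_le_add (add_le_add (h 0) (h 1)) (h 2)) _
    _ = (3⁻¹ * 3) * P {x | 1 / 2 + 5 * t < |x - 1 / 2|} := by ring
    _ = _ := by rw [ENNReal.inv_mul_cancel (by norm_num) (by norm_num), one_mul]

variable {P : Measure ℝ} [IsProbabilityMeasure P]

theorem IsSelfSimilar.measure_tail_eq_zero (hP : IsSelfSimilar P) {t : ℝ} (ht : 0 < t) :
    P {x | 1 / 2 + t < |x - 1 / 2|} = 0 := by
  have hle (n : ℕ) : P {x | 1 / 2 + t < |x - 1 / 2|} ≤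
      P {x | 1 / 2 + 5 ^ n * t < |x - 1 / 2|} := by
    induction n with
    | zero => simp
    | succ n ih =>
      refine ih.trans ((hP.measure_tail_le _).trans_eq ?_)
      rw [pow_succ', mul_assoc]
  have hanti : Antitone fun n : ℕ => {x : ℝ | 1 / 2 + 5 ^ n * t < |x - 1 / 2|} := by
    intro m n hmn x hx
    have : (5 : ℝ) ^ m ≤ 5 ^ n := pow_le_pow_right₀ (by norm_num) hmn
    have := mul_le_mul_of_nonneg_right this ht.le
    simp only [Set.mem_ofPred_eq] at hx ⊢
    linarith
  have hempty : ⋂ n : ℕ, {x : ℝ | 1 / 2 + 5 ^ n * t < |x - 1 / 2|} = ∅ := by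
    ext x
    simp only [Set.mem_iInter, Set.mem_ofPred_eq, Set.mem_empty_iff_false, iff_false, not_forall,
      not_lt]
    obtain ⟨n, hn⟩ := pow_unbounded_of_one_lt (|x - 1 / 2| / t) (by norm_num : (1 : ℝ) < 5)
    refine ⟨n, ?_⟩
    rw [div_lt_iff₀ ht] at hn
    linarith
  have hlim := tendsto_measure_iInter_atTop (μ := P)
    (s := fun n : ℕ => {x : ℝ | 1 / 2 + 5 ^ n * t < |x - 1 / 2|})
    (fun n => (measurableSet_lt measurable_const (by fun_prop)).nullMeasurableSet) hanti
    ⟨0, measure_ne_top _ _⟩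
  rw [hempty, measure_empty] at hlim
  exact le_antisymm (ge_of_tendsto' hlim hle) zero_le

theorem IsSelfSimilar.ae_mem_Icc (hP : IsSelfSimilar P) : ∀ᵐ x ∂P, x ∈ Set.Icc (0 : ℝ) 1 := by
  have h : ∀ n : ℕ, ∀ᵐ x ∂P, ¬ (1 / 2 + 1 / ((n : ℝ) + 1) < |x - 1 / 2|) := by
    intro n
    rw [ae_iff]
    simpa only [not_not] using
      hP.measure_tail_eq_zero (t := 1 / ((n : ℝ) + 1)) (by positivity)
  filter_upwards [ae_all_iff.2 h] with x hx
  have : |x - 1 / 2| ≤ 1 / 2 := by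
    refine le_of_forall_pos_lt_add fun ε hε => ?_
    obtain ⟨n, hn⟩ := exists_nat_one_div_lt hε
    have := not_lt.1 (hx n)
    linarith
  rw [abs_le] at this
  exact ⟨by linarith, by linarith⟩

theorem IsSelfSimilar.restrict_Icc (hP : IsSelfSimilar P) :
    P.restrict (Set.Icc 0 1) = P :=
  Measure.restrict_eq_self_of_ae_mem hP.ae_mem_Icc

theorem IsSelfSimilar.integrable (hP : IsSelfSimilar P) {f : ℝ → ℝ} (hf : Continuous f) :
    Integrable f P := by
  rw [← hP.restrict_Icc]
  exact hf.continuousOn.integrableOn_Icc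

theorem IsSelfSimilar.integral_mono (hP : IsSelfSimilar P) {f g : ℝ → ℝ} (hf : Continuous f)
    (hg : Continuous g) (h : ∀ x, 0 ≤ x → x ≤ 1 → f x ≤ g x) : ∫ x, f x ∂P ≤ ∫ x, g x ∂P := by
  refine integral_mono_ae (hP.integrable hf) (hP.integrable hg) ?_
  filter_upwards [hP.ae_mem_Icc] with x hx using h x hx.1 hx.2

theorem IsSelfSimilar.integral_eq (hP : IsSelfSimilar P) {f : ℝ → ℝ} (hf : Continuous f) :
    ∫ x, f x ∂P = ((∫ x, f (S 0 x) ∂P) + (∫ x, f (S 1 x) ∂P) + ∫ x, f (S 2 x) ∂P) / 3 := by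
  have hi (j : Fin 3) : Integrable f (P.map (S j)) :=
    (integrable_map_measure hf.aestronglyMeasurable (measurable_S j).aemeasurable).2
      (hP.integrable (hf.comp (continuous_S j)))
  conv_lhs => rw [hP]
  rw [integral_smul_measure, integral_finsetSum_measure fun j _ => hi j, Fin.sum_univ_three]
  simp only [integral_map (measurable_S _).aemeasurable hf.aestronglyMeasurable]
  simp
  ring

theorem IsSelfSimilar.integral_id (hP : IsSelfSimilar P) : ∫ x, x ∂P = 1 / 2 := by
  have h := hP.integral_eq continuous_id
  simp only [id, S_zero, S_one, S_two] at h
  have hi : Integrable (fun x : ℝ => x / 5) P := hP.integrable (by fun_prop)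
  rw [integral_add hi (integrable_const _), integral_add hi (integrable_const _),
    integral_div] at h
  simp at h
  linarith

theorem IsSelfSimilar.integral_quadratic_aux (hP : IsSelfSimilar P) (A B C : ℝ) :
    ∫ x, (A + B * x + C * x ^ 2) ∂P = A + B / 2 + C * ∫ x, x ^ 2 ∂P := by
  rw [integral_add (hP.integrable (by fun_prop)) (hP.integrable (by fun_prop)),
    integral_add (hP.integrable (by fun_prop)) (hP.integrable (by fun_prop)),
    integral_const_mul, integral_const_mul, hP.integral_id]
  simp
  ring

theorem IsSelfSimilar.integral_sq (hP : IsSelfSimilar P) : ∫ x, x ^ 2 ∂P = 13 / 36 := by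
  have h := hP.integral_eq (f := fun x => x ^ 2) (by fun_prop)
  have e0 : ∀ x, (S 0 x) ^ 2 = 0 + 0 * x + 1 / 25 * x ^ 2 := fun x => by rw [S_zero]; ring
  have e1 : ∀ x, (S 1 x) ^ 2 = 4 / 25 + 4 / 25 * x + 1 / 25 * x ^ 2 := fun x => by
    rw [S_one]; ring
  have e2 : ∀ x, (S 2 x) ^ 2 = 16 / 25 + 8 / 25 * x + 1 / 25 * x ^ 2 := fun x => by
    rw [S_two]; ring
  simp only [e0, e1, e2] at h
  rw [hP.integral_quadratic_aux, hP.integral_quadratic_aux, hP.integral_quadratic_aux] at h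
  linarith

theorem IsSelfSimilar.integral_quadratic (hP : IsSelfSimilar P) (A B C : ℝ) :
    ∫ x, (A + B * x + C * x ^ 2) ∂P = A + B / 2 + C * (13 / 36) := by
  rw [hP.integral_quadratic_aux, hP.integral_sq]

theorem IsSelfSimilar.integral_sub_sq (hP : IsSelfSimilar P) (r s : ℝ) :
    ∫ x, (r * x - s) ^ 2 ∂P = r ^ 2 / 9 + (r / 2 - s) ^ 2 := by
  have : ∀ x, (r * x - s) ^ 2 = s ^ 2 + -2 * r * s * x + r ^ 2 * x ^ 2 := fun x => by ring
  simp only [this]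
  rw [hP.integral_quadratic]
  ring

/-- The main tool for lower bounds: a quadratic minorant on [0,1] integrates explicitly through the
first two moments 1/2 and 13/36. -/
theorem IsSelfSimilar.le_integral (hP : IsSelfSimilar P) {f : ℝ → ℝ} (hf : Continuous f)
    (A B C : ℝ) (h : ∀ x, 0 ≤ x → x ≤ 1 → A + B * x + C * x ^ 2 ≤ f x) :
    A + B / 2 + C * (13 / 36) ≤ ∫ x, f x ∂P := by
  rw [← hP.integral_quadratic]
  exact hP.integral_mono (by fun_prop) hf h

theorem IsSelfSimilar.variance_eq (hP : IsSelfSimilar P) :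
    ProbabilityTheory.variance (fun x : ℝ => x) P = 1 / 9 := by
  have hL : MemLp (fun x : ℝ => x) 2 P := by
    rw [memLp_two_iff_integrable_sq (by fun_prop)]
    exact hP.integrable (by fun_prop)
  rw [ProbabilityTheory.variance_eq_sub hL, hP.integral_id]
  have : ∫ x, ((fun x : ℝ => x) ^ 2) x ∂P = 13 / 36 := hP.integral_sq
  rw [this]
  norm_num

/-! ### The distortion -/

/-- The squared distance of `x` to the finite set `α`. -/
noncomputable def minSq (α : Finset ℝ) (x : ℝ) : ℝ := ⨅ a : α, (x - (a : ℝ)) ^ 2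

theorem distortion_eq (μ : Measure ℝ) (α : Finset ℝ) : distortion μ α = ∫ x, minSq α x ∂μ := rfl

theorem minSq_le {α : Finset ℝ} {a : ℝ} (ha : a ∈ α) (x : ℝ) : minSq α x ≤ (x - a) ^ 2 :=
  ciInf_le (f := fun a : α => (x - (a : ℝ)) ^ 2) ⟨0, by rintro _ ⟨b, rfl⟩; positivity⟩ ⟨a, ha⟩

theorem le_minSq {α : Finset ℝ} (hα : α.Nonempty) {x c : ℝ} (h : ∀ a ∈ α, c ≤ (x - a) ^ 2) :
    c ≤ minSq α x := by
  have := hα.to_subtype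
  exact le_ciInf fun a => h a a.2

theorem minSq_nonneg (α : Finset ℝ) (x : ℝ) : 0 ≤ minSq α x :=
  Real.iInf_nonneg fun _ => by positivity

theorem continuous_minSq (α : Finset ℝ) : Continuous (minSq α) := by
  rcases α.eq_empty_or_nonempty with rfl | hα
  -- The real infimum over an empty index type is 0.
  · have : minSq ∅ = fun _ => 0 := by ext x; simp [minSq]
    rw [this]
    exact continuous_const
  · have := hα.to_subtype
    have h : minSq α = fun x => (Finset.univ : Finset α).inf' Finset.univ_nonempty
        fun a => (x - (a : ℝ)) ^ 2 := by
      ext x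
      rw [Finset.inf'_univ_eq_ciInf]
      rfl
    rw [h]
    exact Continuous.finset_inf'_apply _ fun a _ => by fun_prop

theorem minSq_affine {α : Finset ℝ} (hα : α.Nonempty) {r : ℝ} (hr : 0 < r) (t x : ℝ) :
    minSq α (x / r + t) = (minSq (α.image fun y => r * (y - t)) x) / r ^ 2 := by
  apply le_antisymm
  · rw [le_div_iff₀ (by positivity)]
    refine le_minSq (hα.image _) fun b hb => ?_
    obtain ⟨a, ha, rfl⟩ := Finset.mem_image.1 hb
    have := mul_le_mul_of_nonneg_right (minSq_le ha (x / r + t)) (sq_nonneg r)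
    refine this.trans_eq ?_
    field_simp
    ring
  · refine le_minSq hα fun a ha => ?_
    rw [div_le_iff₀ (by positivity)]
    refine (minSq_le (Finset.mem_image_of_mem _ ha) x).trans_eq ?_
    field_simp
    ring

/-- The inverse of the similarity `S j`. -/
noncomputable def Sinv (j : Fin 3) (y : ℝ) : ℝ := 5 * (y - 2 * ((j : ℕ) : ℝ) / 5)

theorem Sinv_injective (j : Fin 3) : Function.Injective (Sinv j) := by
  intro x y h
  simp only [Sinv] at h
  linarith

theorem minSq_S {α : Finset ℝ} (hα : α.Nonempty) (j : Fin 3) (x : ℝ) :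
    minSq α (S j x) = minSq (α.image (Sinv j)) x / 25 := by
  have := minSq_affine hα (r := 5) (by norm_num) (2 * ((j : ℕ) : ℝ) / 5) x
  norm_num at this
  exact this

/-- Here 75 = 3 · 25: mass 1/3 for each piece, and 1/25 from scaling squared distances. -/
theorem IsSelfSimilar.distortion_split (hP : IsSelfSimilar P) {α : Finset ℝ} (hα : α.Nonempty) :
    distortion P α = (distortion P (α.image (Sinv 0)) + distortion P (α.image (Sinv 1)) +
      distortion P (α.image (Sinv 2))) / 75 := by
  simp only [distortion_eq]
  rw [hP.integral_eq (continuous_minSq α)]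
  simp only [minSq_S hα, integral_div]
  ring

theorem IsSelfSimilar.distortion_mono (hP : IsSelfSimilar P) {α β : Finset ℝ}
    (h : ∀ x, 0 ≤ x → x ≤ 1 → minSq α x ≤ minSq β x) : distortion P α ≤ distortion P β :=
  hP.integral_mono (continuous_minSq α) (continuous_minSq β) h

theorem IsSelfSimilar.distortion_singleton (hP : IsSelfSimilar P) (a : ℝ) :
    distortion P {a} = 1 / 9 + (1 / 2 - a) ^ 2 := by
  have h : ∀ x, minSq {a} x = (1 * x - a) ^ 2 := fun x => by
    rw [one_mul]
    exact le_antisymm (minSq_le (by simp) x) (le_minSq (by simp) (by simp))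
  simp only [distortion_eq, h]
  rw [hP.integral_sub_sq]
  norm_num

/-! ### Reflection -/

theorem S_reflect (j : Fin 3) (x : ℝ) : S j (1 - x) = 1 - S (Fin.rev j) x := by
  fin_cases j
  · change S 0 _ = 1 - S 2 _
    rw [S_zero, S_two]; ring
  · change S 1 _ = 1 - S 1 _
    rw [S_one, S_one]; ring
  · change S 2 _ = 1 - S 0 _
    rw [S_zero, S_two]; ring

/-- One-sided estimates are proved for every self-similar probability measure, so they can be
applied to the mirror image without knowing that it equals P. -/
theorem IsSelfSimilar.reflect {μ : Measure ℝ} (hP : IsSelfSimilar μ) :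
    IsSelfSimilar (μ.map fun x => 1 - x) := by
  have hr : Measurable fun x : ℝ => 1 - x := by fun_prop
  unfold IsSelfSimilar
  ext A hA
  rw [Measure.map_apply hr hA, hP.apply (hr hA)]
  have h (j : Fin 3) : ((μ.map fun x => 1 - x).map (S j)) A =
      μ (S (Fin.rev j) ⁻¹' ((fun x => 1 - x) ⁻¹' A)) := by
    rw [Measure.map_apply (measurable_S j) hA, Measure.map_apply hr (measurable_S j hA)]
    congr 1
    ext x
    simp [S_reflect]
  rw [Measure.smul_apply, Measure.finsetSum_apply, Finset.sum_congr rfl fun j _ => h j,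
    Fin.sum_univ_three, smul_eq_mul]
  change _ = _ * (μ (S 2 ⁻¹' _) + μ (S 1 ⁻¹' _) + μ (S 0 ⁻¹' _))
  ring

theorem isProbabilityMeasure_reflect : IsProbabilityMeasure (P.map fun x => 1 - x) :=
  Measure.isProbabilityMeasure_map (by fun_prop)

theorem minSq_reflect {α : Finset ℝ} (hα : α.Nonempty) (x : ℝ) :
    minSq (α.image fun y => 1 - y) (1 - x) = minSq α x := by
  apply le_antisymm
  · refine le_minSq hα fun a ha => ?_
    refine (minSq_le (Finset.mem_image_of_mem _ ha) (1 - x)).trans_eq ?_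
    ring
  · refine le_minSq (hα.image _) fun b hb => ?_
    obtain ⟨a, ha, rfl⟩ := Finset.mem_image.1 hb
    refine (minSq_le ha x).trans_eq ?_
    ring

theorem distortion_reflect {μ : Measure ℝ} {α : Finset ℝ} (hα : α.Nonempty) :
    distortion (μ.map fun x => 1 - x) (α.image fun y => 1 - y) = distortion μ α := by
  simp only [distortion_eq]
  rw [integral_map (by fun_prop) (continuous_minSq _).aestronglyMeasurable]
  simp only [minSq_reflect hα]

/-! ### The values of the quantization errors -/

/-- The sequence of quantization errors, defined by distributing the points as evenly as possible
over the three pieces of the Cantor set. -/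
noncomputable def optError (n : ℕ) : ℝ :=
  if n ≤ 1 then 1 / 9 else if n = 2 then 821 / 28125 else
    (optError (n / 3) + optError ((n + 1) / 3) + optError ((n + 2) / 3)) / 75
termination_by n
decreasing_by all_goals omega

theorem optError_one : optError 1 = 1 / 9 := by rw [optError]; simp

theorem optError_two : optError 2 = 821 / 28125 := by rw [optError]; simp

theorem optError_rec {n : ℕ} (hn : 3 ≤ n) :
    optError n = (optError (n / 3) + optError ((n + 1) / 3) + optError ((n + 2) / 3)) / 75 := by
  rw [optError, if_neg (by omega), if_neg (by omega)]

theorem optError_three : optError 3 = 1 / 225 := by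
  rw [optError_rec le_rfl]
  norm_num [optError_one]

/-- The gain from an additional point. -/
noncomputable def gain (n : ℕ) : ℝ := optError n - optError (n + 1)

theorem gain_one : gain 1 = 2304 / 28125 := by
  norm_num [gain, optError_one, optError_two]

theorem gain_two : gain 2 = 696 / 28125 := by
  norm_num [gain, optError_three, optError_two]

/-- Passing from n to n + 1 replaces the part ⌊n/3⌋ by ⌊n/3⌋ + 1 and keeps the other two parts. -/
theorem gain_rec {n : ℕ} (hn : 3 ≤ n) : gain n = gain (n / 3) / 75 := by
  have h3 : (n + 1 + 2) / 3 = n / 3 + 1 := by omega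
  rw [gain, optError_rec hn, optError_rec (by omega : 3 ≤ n + 1), h3, gain]
  ring_nf

theorem gain_nonneg_and_anti (n : ℕ) (hn : 1 ≤ n) : 0 ≤ gain n ∧ gain (n + 1) ≤ gain n := by
  induction n using Nat.strong_induction_on with
  | _ n ih =>
    rcases (by omega : n = 1 ∨ n = 2 ∨ 3 ≤ n) with rfl | rfl | h
    · norm_num [gain_one, gain_two]
    · rw [gain_rec (by norm_num : 3 ≤ 2 + 1)]
      norm_num [gain_one, gain_two]
    · rw [gain_rec h, gain_rec (by omega : 3 ≤ n + 1)]
      have h1 := ih (n / 3) (by omega) (by omega)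
      rcases (by omega : (n + 1) / 3 = n / 3 ∨ (n + 1) / 3 = n / 3 + 1) with h2 | h2 <;> rw [h2]
      · exact ⟨by linarith, le_rfl⟩
      · exact ⟨by linarith, by linarith⟩

theorem gain_nonneg {n : ℕ} (hn : 1 ≤ n) : 0 ≤ gain n := (gain_nonneg_and_anti n hn).1

theorem gain_anti {m n : ℕ} (hm : 1 ≤ m) (hmn : m ≤ n) : gain n ≤ gain m := by
  induction n, hmn using Nat.le_induction with
  | base => exact le_rfl
  | succ k hk ih => exact (gain_nonneg_and_anti k (by omega)).2.trans ih

theorem optError_anti {m n : ℕ} (hm : 1 ≤ m) (hmn : m ≤ n) : optError n ≤ optError m := by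
  induction n, hmn using Nat.le_induction with
  | base => exact le_rfl
  | succ k hk ih =>
    have := gain_nonneg (n := k) (by omega)
    rw [gain] at this
    linarith

/-- Convexity of E: since the gains decrease, E lies above its discrete tangent line at k. -/
theorem tangent_le_optError {k j : ℕ} (hk : 1 ≤ k) (hj : 1 ≤ j) :
    optError k - gain k * ((j : ℝ) - k) ≤ optError j := by
  rcases le_total k j with h | h
  · induction j, h using Nat.le_induction with
    | base => simp
    | succ m hm ih =>
      have h1 := ih (by omega)
      have h2 := gain_anti hk hm
      have h3 : optError (m + 1) = optError m - gain m := by rw [gain]; ring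
      push_cast
      linarith
  · induction k, h using Nat.le_induction with
    | base => simp
    | succ m hm ih =>
      have h1 := ih (by omega)
      have h2 : gain (m + 1) ≤ gain m := gain_anti (by omega) (by omega)
      have h3 : optError (m + 1) = optError m - gain m := by rw [gain]; ring
      have h4 : (j : ℝ) ≤ m := by exact_mod_cast hm
      have h5 := mul_nonneg (sub_nonneg.2 h2) (sub_nonneg.2 h4)
      push_cast
      nlinarith

/-- Add the tangent inequalities at k = ⌊n/3⌋. The parts of the even splitting are k or k + 1, where
the tangent is exact, so the sum of the tangent values is 75 E(n). -/
theorem optError_add_le {a b c : ℕ} (ha : 1 ≤ a) (hb : 1 ≤ b) (hc : 1 ≤ c) :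
    75 * optError (a + b + c) ≤ optError a + optError b + optError c := by
  set n := a + b + c with hn
  have hk : 1 ≤ n / 3 := by omega
  have h1 := tangent_le_optError hk ha
  have h2 := tangent_le_optError hk hb
  have h3 := tangent_le_optError hk hc
  have hs : (n : ℝ) = a + b + c := by rw [hn]; push_cast; ring
  have hE : 75 * optError n = 3 * optError (n / 3) - gain (n / 3) * (n - 3 * (n / 3 : ℕ)) := by
    have hg : optError (n / 3 + 1) = optError (n / 3) - gain (n / 3) := by rw [gain]; ring
    rw [optError_rec (by omega)]
    rcases (by omega : n % 3 = 0 ∨ n % 3 = 1 ∨ n % 3 = 2) with h | h | h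
    · have hm : (n : ℝ) = 3 * (n / 3 : ℕ) := by exact_mod_cast (by omega : n = 3 * (n / 3))
      rw [(by omega : (n + 1) / 3 = n / 3), (by omega : (n + 2) / 3 = n / 3)]
      linear_combination gain (n / 3) * hm
    · have hm : (n : ℝ) = 3 * (n / 3 : ℕ) + 1 := by
        exact_mod_cast (by omega : n = 3 * (n / 3) + 1)
      rw [(by omega : (n + 1) / 3 = n / 3), (by omega : (n + 2) / 3 = n / 3 + 1), hg]
      linear_combination gain (n / 3) * hm
    · have hm : (n : ℝ) = 3 * (n / 3 : ℕ) + 2 := by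
        exact_mod_cast (by omega : n = 3 * (n / 3) + 2)
      rw [(by omega : (n + 1) / 3 = n / 3 + 1), (by omega : (n + 2) / 3 = n / 3 + 1), hg]
      linear_combination gain (n / 3) * hm
  rw [hE, hs]
  linarith

/-- Moving a point from b to the singleton improves the sum by at least `gain 1 - gain 2` =
1608/28125 > 1/20. -/
theorem optError_one_add_le {b c : ℕ} (hb : 3 ≤ b) (hc : 1 ≤ c) :
    75 * optError (1 + b + c) + 1 / 20 ≤ optError 1 + optError b + optError c := by
  obtain ⟨b, rfl⟩ := Nat.exists_eq_add_of_le' (by omega : 1 ≤ b)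
  have h1 := optError_add_le (a := 2) (b := b) (c := c) (by omega) (by omega) hc
  have h2 : gain b ≤ gain 2 := gain_anti (by omega) (by omega)
  have h3 : gain b = optError b - optError (b + 1) := rfl
  rw [gain_two] at h2
  rw [(by ring : 1 + (b + 1) + c = 2 + b + c), optError_one]
  rw [optError_two] at h1
  linarith

/-- The three parts of n stay in the closed range one level down. There the formula is affine, so
only their sum n enters. The closed ranges of this formula and the next one overlap at their
endpoints, as the induction requires. -/
theorem optError_low {l n : ℕ} (h1 : 3 ^ l ≤ n) (h2 : n ≤ 2 * 3 ^ l) :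
    optError n = 1 / 75 ^ l *
      ((2 * 3 ^ l - (n : ℝ)) * (1 / 9) + ((n : ℝ) - 3 ^ l) * (821 / 28125)) := by
  induction l generalizing n with
  | zero =>
    rcases (by simp at h1 h2; omega : n = 1 ∨ n = 2) with rfl | rfl
    · rw [optError_one]; norm_num
    · rw [optError_two]; norm_num
  | succ l ih =>
    rw [pow_succ] at h1 h2
    have hpos : 1 ≤ 3 ^ l := Nat.one_le_pow _ _ (by norm_num)
    rw [optError_rec (by omega), ih (n := n / 3) (by omega) (by omega),
      ih (n := (n + 1) / 3) (by omega) (by omega), ih (n := (n + 2) / 3) (by omega) (by omega)]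
    have hs : ((n / 3 : ℕ) : ℝ) + ((n + 1) / 3 : ℕ) + ((n + 2) / 3 : ℕ) = n := by
      exact_mod_cast (by omega : n / 3 + (n + 1) / 3 + (n + 2) / 3 = n)
    rw [← hs, pow_succ, pow_succ]
    field_simp
    ring

theorem optError_high {l n : ℕ} (h1 : 2 * 3 ^ l ≤ n) (h2 : n ≤ 3 ^ (l + 1)) :
    optError n = 1 / 75 ^ l *
      ((3 ^ (l + 1) - (n : ℝ)) * (821 / 28125) + ((n : ℝ) - 2 * 3 ^ l) * (1 / 225)) := by
  induction l generalizing n with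
  | zero =>
    rcases (by simp at h1 h2; omega : n = 2 ∨ n = 3) with rfl | rfl
    · rw [optError_two]; norm_num
    · rw [optError_three]; norm_num
  | succ l ih =>
    rw [pow_succ] at h1 h2
    have hpos : 1 ≤ 3 ^ l := Nat.one_le_pow _ _ (by norm_num)
    have e : 3 ^ (l + 1) = 3 ^ l * 3 := pow_succ _ _
    rw [optError_rec (by omega), ih (n := n / 3) (by omega) (by omega),
      ih (n := (n + 1) / 3) (by omega) (by omega), ih (n := (n + 2) / 3) (by omega) (by omega)]
    have hs : ((n / 3 : ℕ) : ℝ) + ((n + 1) / 3 : ℕ) + ((n + 2) / 3 : ℕ) = n := by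
      exact_mod_cast (by omega : n / 3 + (n + 1) / 3 + (n + 2) / 3 = n)
    rw [← hs, pow_succ _ (l + 1), pow_succ, pow_succ]
    field_simp
    ring

/-! ### Lower bounds for sets with few points near the unit interval -/

theorem sub_sq_le_right {x p e : ℝ} (h : p ≤ e) (h' : 2 * x ≤ p + e) :
    (x - p) ^ 2 ≤ (x - e) ^ 2 := by
  nlinarith [mul_nonneg (sub_nonneg.2 h) (sub_nonneg.2 h')]

theorem sub_sq_le_left {x p e : ℝ} (h : e ≤ p) (h' : p + e ≤ 2 * x) :
    (x - p) ^ 2 ≤ (x - e) ^ 2 := by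
  nlinarith [mul_nonneg (sub_nonneg.2 h) (sub_nonneg.2 h')]

theorem sq_le_sub_sq {x c e : ℝ} (hc : 0 ≤ c) (h : c ≤ x - e ∨ c ≤ e - x) :
    c ^ 2 ≤ (x - e) ^ 2 := by
  rcases h with h | h <;> nlinarith

theorem integral_minSq_S_nonneg {P : Measure ℝ} (α : Finset ℝ) (j : Fin 3) :
    0 ≤ ∫ x, minSq α (S j x) ∂P :=
  integral_nonneg fun _ => minSq_nonneg _ _

theorem continuous_minSq_S (α : Finset ℝ) (j : Fin 3) : Continuous fun x => minSq α (S j x) :=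
  (continuous_minSq α).comp (continuous_S j)

theorem IsSelfSimilar.distortion_eq_thirds (hP : IsSelfSimilar P) (α : Finset ℝ) :
    distortion P α = ((∫ x, minSq α (S 0 x) ∂P) + (∫ x, minSq α (S 1 x) ∂P) +
      ∫ x, minSq α (S 2 x) ∂P) / 3 :=
  hP.integral_eq (continuous_minSq α)

theorem IsSelfSimilar.distortion_ge_of_far (hP : IsSelfSimilar P) {α : Finset ℝ}
    (hα : α.Nonempty) {u : ℝ} (hu : 0 ≤ u) (h : ∀ a ∈ α, a ≤ -u ∨ 1 + u ≤ a) :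
    (2 * u ^ 2 + (u + 2 / 5) ^ 2) / 3 ≤ distortion P α := by
  rw [hP.distortion_eq_thirds]
  have h0 := hP.le_integral (continuous_minSq_S α 0) (u ^ 2) 0 0 fun x hx0 hx1 => by
    refine le_minSq hα fun a ha => ?_
    rw [S_zero]
    have := sq_le_sub_sq (x := x / 5) (e := a) hu
      ((h a ha).imp (fun h => by linarith) (fun h => by linarith))
    linarith
  have h1 := hP.le_integral (continuous_minSq_S α 1) ((u + 2 / 5) ^ 2) 0 0 fun x hx0 hx1 => by
    refine le_minSq hα fun a ha => ?_
    rw [S_one]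
    have := sq_le_sub_sq (x := x / 5 + 2 / 5) (e := a) (c := u + 2 / 5) (by linarith)
      ((h a ha).imp (fun h => by linarith) (fun h => by linarith))
    linarith
  have h2 := hP.le_integral (continuous_minSq_S α 2) (u ^ 2) 0 0 fun x hx0 hx1 => by
    refine le_minSq hα fun a ha => ?_
    rw [S_two]
    have := sq_le_sub_sq (x := x / 5 + 4 / 5) (e := a) hu
      ((h a ha).imp (fun h => by linarith) (fun h => by linarith))
    linarith
  linarith

theorem IsSelfSimilar.distortion_ge_of_far_right (hP : IsSelfSimilar P) {α : Finset ℝ}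
    (hα : α.Nonempty) (h : ∀ a ∈ α, a ≤ 1 / 2 ∨ 3 / 2 ≤ a) : 1 / 20 ≤ distortion P α := by
  rw [hP.distortion_eq_thirds]
  have h0 := integral_minSq_S_nonneg (P := P) α 0
  have h1 := integral_minSq_S_nonneg (P := P) α 1
  have h2 := hP.le_integral (continuous_minSq_S α 2) (9 / 100) (12 / 100) (4 / 100)
    fun x hx0 hx1 => by
      refine le_minSq hα fun a ha => ?_
      rw [S_two]
      have := sq_le_sub_sq (x := x / 5 + 4 / 5) (e := a) (c := x / 5 + 3 / 10) (by linarith)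
        ((h a ha).imp (fun h => by linarith) (fun h => by linarith))
      linarith
  linarith

theorem IsSelfSimilar.distortion_ge_of_two (hP : IsSelfSimilar P) {α : Finset ℝ}
    (hα : α.Nonempty) (h : ∀ a ∈ α, a ≤ -3 / 8 ∨ 1 / 2 ≤ a) :
    821 / 28125 + 1 / 125 ≤ distortion P α := by
  rw [hP.distortion_eq_thirds]
  have h0 := hP.le_integral (continuous_minSq_S α 0) (14 / 100) (-5 / 100) 0
    fun x hx0 hx1 => by
      refine le_minSq hα fun a ha => ?_
      rw [S_zero]
      rcases h a ha with h | h
      · have := sq_le_sub_sq (x := x / 5) (e := a) (c := 3 / 8) (by norm_num)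
          (Or.inl (by linarith))
        linarith
      · have := sq_le_sub_sq (x := x / 5) (e := a) (c := 1 / 2 - x / 5) (by linarith)
          (Or.inr (by linarith))
        nlinarith [mul_nonneg (sub_nonneg.2 hx1) (by linarith : 0 ≤ 11 - 4 * x)]
  have h1 := integral_minSq_S_nonneg (P := P) α 1
  have h2 := integral_minSq_S_nonneg (P := P) α 2
  linarith

theorem IsSelfSimilar.distortion_ge_of_left (hP : IsSelfSimilar P) {α : Finset ℝ}
    (hα : α.Nonempty) (h : ∀ a ∈ α, a ≤ 0 ∨ 3 / 2 ≤ a) : 1 / 9 ≤ distortion P α := by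
  rw [hP.distortion_eq_thirds]
  have h0 := integral_minSq_S_nonneg (P := P) α 0
  have h1 := hP.le_integral (continuous_minSq_S α 1) ((2 / 5) ^ 2) 0 0 fun x hx0 hx1 => by
    refine le_minSq hα fun a ha => ?_
    rw [S_one]
    have := sq_le_sub_sq (x := x / 5 + 2 / 5) (e := a) (c := 2 / 5) (by norm_num)
      ((h a ha).imp (fun h => by linarith) (fun h => by linarith))
    linarith
  have h2 := hP.le_integral (continuous_minSq_S α 2) ((1 / 2) ^ 2) 0 0 fun x hx0 hx1 => by
    refine le_minSq hα fun a ha => ?_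
    rw [S_two]
    have := sq_le_sub_sq (x := x / 5 + 4 / 5) (e := a) (c := 1 / 2) (by norm_num)
      ((h a ha).imp (fun h => by linarith) (fun h => by linarith))
    linarith
  linarith

theorem IsSelfSimilar.distortion_ge_of_one_left (hP : IsSelfSimilar P) {α : Finset ℝ}
    (hα : α.Nonempty) {p : ℝ} (hp0 : 0 ≤ p) (hp : p ≤ 17 / 50)
    (h : ∀ a ∈ α, a = p ∨ a ≤ -1 / 2 ∨ 3 / 2 ≤ a) : 1 / 9 ≤ distortion P α := by
  have key : ∀ x, 0 ≤ x → x ≤ 3 / 5 → (x - p) ^ 2 ≤ minSq α x := fun x hx0 hx1 => by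
    refine le_minSq hα fun a ha => ?_
    rcases h a ha with rfl | h | h
    · exact le_rfl
    · exact sub_sq_le_left (by linarith) (by linarith)
    · exact sub_sq_le_right (by linarith) (by linarith)
  rw [hP.distortion_eq_thirds]
  have h0 := hP.le_integral (continuous_minSq_S α 0) (p ^ 2) (-2 * p / 5) (1 / 25)
    fun x hx0 hx1 => by
      rw [S_zero]
      have := key (x / 5) (by linarith) (by linarith)
      linarith
  have h1 := hP.le_integral (continuous_minSq_S α 1) ((2 / 5 - p) ^ 2) (2 * (2 / 5 - p) / 5)
    (1 / 25) fun x hx0 hx1 => by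
      rw [S_one]
      have := key (x / 5 + 2 / 5) (by linarith) (by linarith)
      linarith
  -- This concave parabola is tangent to (x/5 + 23/50)² at x = 0 and meets (7/10 - x/5)² at x = 1.
  -- These bound the squared distances to points left of 17/50 and right of 3/2.
  have h2 := hP.le_integral (continuous_minSq_S α 2) (2116 / 10000) (1840 / 10000)
    (-1456 / 10000) fun x hx0 hx1 => by
      refine le_minSq hα fun a ha => ?_
      rw [S_two]
      have hl (hap : a ≤ 17 / 50) : 2116 / 10000 + 1840 / 10000 * x + -1456 / 10000 * x ^ 2 ≤
          (x / 5 + 4 / 5 - a) ^ 2 := by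
        have := sq_le_sub_sq (x := x / 5 + 4 / 5) (e := a) (c := x / 5 + 23 / 50) (by linarith)
          (Or.inl (by linarith))
        nlinarith [sq_nonneg x]
      rcases h a ha with rfl | h | h
      · exact hl hp
      · exact hl (by linarith)
      · have := sq_le_sub_sq (x := x / 5 + 4 / 5) (e := a) (c := 7 / 10 - x / 5) (by linarith)
          (Or.inr (by linarith))
        nlinarith [mul_nonneg (sub_nonneg.2 hx1) (by linarith : 0 ≤ 2784 - 1856 * x)]
  nlinarith [sq_nonneg (p - 3 / 10)]

/-- For p ≥ 17/50 the midpoint of p and 3/2 is at least 23/25, the right end of J₃₂, so foreign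
points matter only on J₃₃. There, a piece of mass 1/9, they save at most (3/2 - p)(1/2 - p), the
value at x = 1. -/
theorem IsSelfSimilar.distortion_ge_of_one_mid (hP : IsSelfSimilar P) {α : Finset ℝ}
    (hα : α.Nonempty) {p : ℝ} (hp0 : 17 / 50 ≤ p) (hp : p ≤ 1 / 2)
    (h : ∀ a ∈ α, a = p ∨ a ≤ -1 / 2 ∨ 3 / 2 ≤ a) :
    1 / 9 + (1 / 2 - p) * (8 * (1 / 2 - p) - 1) / 9 ≤ distortion P α := by
  have key : ∀ x, 0 ≤ x → x ≤ 23 / 25 → (x - p) ^ 2 ≤ minSq α x := fun x hx0 hx1 => by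
    refine le_minSq hα fun a ha => ?_
    rcases h a ha with rfl | h | h
    · exact le_rfl
    · exact sub_sq_le_left (by linarith) (by linarith)
    · exact sub_sq_le_right (by linarith) (by linarith)
  rw [hP.distortion_eq_thirds, hP.integral_eq (continuous_minSq_S α 2)]
  have h0 := hP.le_integral (continuous_minSq_S α 0) (p ^ 2) (-2 * p / 5) (1 / 25)
    fun x hx0 hx1 => by
      rw [S_zero]
      have := key (x / 5) (by linarith) (by linarith)
      linarith
  have h1 := hP.le_integral (continuous_minSq_S α 1) ((2 / 5 - p) ^ 2) (2 * (2 / 5 - p) / 5)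
    (1 / 25) fun x hx0 hx1 => by
      rw [S_one]
      have := key (x / 5 + 2 / 5) (by linarith) (by linarith)
      linarith
  have h2 (j : Fin 3) := ((continuous_minSq_S α 2).comp (continuous_S j))
  have h20 := hP.le_integral (h2 0) ((4 / 5 - p) ^ 2) (2 * (4 / 5 - p) / 25)
    (1 / 625) fun x hx0 hx1 => by
      simp only [Function.comp, S_two, S_zero]
      have := key (x / 5 / 5 + 4 / 5) (by linarith) (by linarith)
      linarith
  have h21 := hP.le_integral (h2 1) ((22 / 25 - p) ^ 2) (2 * (22 / 25 - p) / 25)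
    (1 / 625) fun x hx0 hx1 => by
      simp only [Function.comp, S_two, S_one]
      have := key ((x / 5 + 2 / 5) / 5 + 4 / 5) (by linarith) (by linarith)
      linarith
  have h22 := hP.le_integral (h2 2)
    ((24 / 25 - p) ^ 2 - (3 / 2 - p) * (1 / 2 - p)) (2 * (24 / 25 - p) / 25)
    (1 / 625) fun x hx0 hx1 => by
      simp only [Function.comp, S_two]
      refine le_minSq hα fun a ha => ?_
      have hpp : 0 ≤ (3 / 2 - p) * (1 / 2 - p) := mul_nonneg (by linarith) (by linarith)
      rcases h a ha with rfl | h | h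
      · linarith
      · have := sub_sq_le_left (x := (x / 5 + 4 / 5) / 5 + 4 / 5) (p := p) (e := a) (by linarith)
          (by linarith)
        linarith
      · have := sub_sq_le_right (x := (x / 5 + 4 / 5) / 5 + 4 / 5) (p := 3 / 2) (e := a)
          (by linarith) (by linarith)
        nlinarith [mul_nonneg (by linarith : 0 ≤ 3 / 2 - p) (sub_nonneg.2 hx1)]
  simp only [Function.comp] at h20 h21 h22
  linarith

/-- With t = 1/2 - p, the correction t(8t - 1)/9 is nonnegative for t ≥ 1/8, and its minimum -1/288
is attained at t = 1/16. For p ≥ 3/8 a foreign point beyond 13/8 has its midpoint with p beyond 1,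
hence is useless on [0,1]. -/
theorem IsSelfSimilar.distortion_one_of_le (hP : IsSelfSimilar P) {α : Finset ℝ}
    {p : ℝ} (hpα : p ∈ α) (hp : p ≤ 1 / 2)
    (h : ∀ a ∈ α, a = p ∨ a ≤ -1 / 2 ∨ 3 / 2 ≤ a) :
    1 / 9 ≤ distortion P α ∨
      (1 / 9 - 1 / 288 ≤ distortion P α ∧ ∃ q ∈ α, q ≠ p ∧ 3 / 2 ≤ q ∧ q ≤ 13 / 8) := by
  have hα : α.Nonempty := ⟨p, hpα⟩
  rcases le_total p 0 with hp0 | hp0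
  · refine Or.inl (hP.distortion_ge_of_left hα fun a ha => ?_)
    rcases h a ha with rfl | h | h
    · exact Or.inl hp0
    · exact Or.inl (by linarith)
    · exact Or.inr h
  rcases le_total p (17 / 50) with hp1 | hp1
  · exact Or.inl (hP.distortion_ge_of_one_left hα hp0 hp1 h)
  have hD := hP.distortion_ge_of_one_mid hα hp1 hp h
  rcases le_total p (3 / 8) with hp2 | hp2
  · left
    nlinarith [mul_nonneg (sub_nonneg.2 hp) (sub_nonneg.2 hp2)]
  by_cases hq : ∃ q ∈ α, 3 / 2 ≤ q ∧ q ≤ 13 / 8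
  · right
    obtain ⟨q, hqα, hq⟩ := hq
    refine ⟨?_, q, hqα, by rintro rfl; linarith, hq⟩
    nlinarith [sq_nonneg (p - 7 / 16)]
  · left
    push Not at hq
    have hle : distortion P {p} ≤ distortion P α := hP.distortion_mono fun x hx0 hx1 => by
      refine (minSq_le (Finset.mem_singleton_self p) x).trans (le_minSq hα fun a ha => ?_)
      rcases h a ha with rfl | h | h
      · exact le_rfl
      · exact sub_sq_le_left (by linarith) (by linarith)
      · have := hq a ha h
        exact sub_sq_le_right (by linarith) (by linarith)
    rw [hP.distortion_singleton] at hle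
    nlinarith [sq_nonneg (1 / 2 - p)]

theorem forall_mem_reflect {α : Finset ℝ} {p : ℝ → Prop} :
    (∀ a ∈ α.image fun y => 1 - y, p a) ↔ ∀ a ∈ α, p (1 - a) := by
  simp

theorem IsSelfSimilar.distortion_one (hP : IsSelfSimilar P) {α : Finset ℝ}
    {p : ℝ} (hpα : p ∈ α) (h : ∀ a ∈ α, a = p ∨ a ≤ -1 / 2 ∨ 3 / 2 ≤ a) :
    1 / 9 ≤ distortion P α ∨ (1 / 9 - 1 / 288 ≤ distortion P α ∧
      ∃ q ∈ α, q ≠ p ∧ ((3 / 2 ≤ q ∧ q ≤ 13 / 8) ∨ (-5 / 8 ≤ q ∧ q ≤ -1 / 2))) := by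
  rcases le_total p (1 / 2) with hp | hp
  · refine (hP.distortion_one_of_le hpα hp h).imp_right fun ⟨h1, q, hq, hqp, h2⟩ =>
      ⟨h1, q, hq, hqp, Or.inl h2⟩
  · have := isProbabilityMeasure_reflect (P := P)
    have hr := hP.reflect.distortion_one_of_le (α := α.image fun y => 1 - y) (p := 1 - p)
      (Finset.mem_image_of_mem _ hpα) (by linarith) (forall_mem_reflect.2 fun a ha => by
        rcases h a ha with rfl | h | h
        · exact Or.inl rfl
        · exact Or.inr (Or.inr (by linarith))
        · exact Or.inr (Or.inl (by linarith)))
    rw [distortion_reflect ⟨p, hpα⟩] at hr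
    refine hr.imp_right fun ⟨h1, q, hq, hqp, h2⟩ =>
      ⟨h1, 1 - q, ?_, fun h => hqp (by linarith), Or.inr ?_⟩
    · obtain ⟨a, ha, rfl⟩ := Finset.mem_image.1 hq
      simpa using ha
    · exact ⟨by linarith, by linarith⟩

/-- If a foreign q ≥ 3/2 beats all of β at some x ≤ 1, then every b in β satisfies b + q < 2x ≤ 2,
so b < 1/2, and the last third alone already costs 1/20. The left side is symmetric. -/
theorem IsSelfSimilar.distortion_ge_of_subset (hP : IsSelfSimilar P) {α β : Finset ℝ}
    (hβ : β.Nonempty) (hsub : β ⊆ α) (h : ∀ a ∈ α, a ∈ β ∨ a ≤ -1 / 2 ∨ 3 / 2 ≤ a) {e : ℝ}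
    (he : e ≤ 1 / 20) (hle : e ≤ distortion P β) : e ≤ distortion P α := by
  have hα := hβ.mono hsub
  by_cases hx : ∀ x, 0 ≤ x → x ≤ 1 → minSq β x ≤ minSq α x
  · exact hle.trans (hP.distortion_mono hx)
  push Not at hx
  obtain ⟨x, hx0, hx1, hlt⟩ := hx
  obtain ⟨q, hq, hqx⟩ : ∃ q ∈ α, (x - q) ^ 2 < minSq β x := by
    by_contra hcon
    push Not at hcon
    exact absurd (le_minSq hα hcon) (not_le.2 hlt)
  have hb : ∀ b ∈ β, (x - q) ^ 2 < (x - b) ^ 2 := fun b hb => hqx.trans_le (minSq_le hb x)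
  have hqβ : q ∉ β := fun h => lt_irrefl _ (hb q h)
  refine he.trans ?_
  rcases (h q hq).resolve_left hqβ with hq' | hq'
  · have := isProbabilityMeasure_reflect (P := P)
    rw [← distortion_reflect hα]
    refine hP.reflect.distortion_ge_of_far_right (hα.image _) (forall_mem_reflect.2 fun a ha => ?_)
    rcases h a ha with ha' | ha' | ha'
    · have := hb a ha'
      by_contra! hcon
      nlinarith [mul_nonneg (by linarith : 0 ≤ a - q) (by linarith : 0 ≤ 2 * x - a - q)]
    · exact Or.inr (by linarith)
    · exact Or.inl (by linarith)
  · refine hP.distortion_ge_of_far_right hα fun a ha => ?_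
    rcases h a ha with ha' | ha' | ha'
    · have := hb a ha'
      by_contra! hcon
      nlinarith [mul_nonneg (by linarith : 0 ≤ q - a) (by linarith : 0 ≤ a + q - 2 * x)]
    · exact Or.inl (by linarith)
    · exact Or.inr ha'

/-! ### Two points -/

theorem continuous_minSq_S_S (α : Finset ℝ) (i j : Fin 3) :
    Continuous fun x => minSq α (S i (S j x)) :=
  (continuous_minSq_S α i).comp (continuous_S j)

/-- The integral of `(x / r + t - b) ^ 2 - (c - d * x)` as a lower bound. -/
theorem IsSelfSimilar.le_integral_sq (hP : IsSelfSimilar P) {f : ℝ → ℝ} (hf : Continuous f)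
    (r t c d : ℝ) (h : ∀ x, 0 ≤ x → x ≤ 1 → (r * x + t) ^ 2 - (c - d * x) ≤ f x) :
    r ^ 2 / 9 + (r / 2 + t) ^ 2 - (c - d / 2) ≤ ∫ x, f x ∂P := by
  have := hP.le_integral hf (t ^ 2 - c) (2 * r * t + d) (r ^ 2) fun x hx0 hx1 => by
    linarith [h x hx0 hx1]
  linarith

theorem sub_sq_le_minSq_pair_left {a b x : ℝ} (hab : a ≤ b) (hx : 2 * x ≤ a + b) :
    (x - a) ^ 2 ≤ minSq {a, b} x :=
  le_minSq (by simp) (by simpa using sub_sq_le_right hab hx)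

theorem sub_sq_le_minSq_pair_right {a b x : ℝ} (hab : a ≤ b) (hx : a + b ≤ 2 * x) :
    (x - b) ^ 2 ≤ minSq {a, b} x :=
  le_minSq (by simp) (by simpa using sub_sq_le_left hab (by linarith))

theorem le_minSq_pair {a b x w : ℝ} (h1 : w ≤ (x - a) ^ 2) (h2 : w ≤ (x - b) ^ 2) :
    w ≤ minSq {a, b} x :=
  le_minSq (by simp) (by simpa using ⟨h1, h2⟩)

/-- The integral over `J₁` when it is served by `a`. -/
theorem IsSelfSimilar.le_integral_pair_zero (hP : IsSelfSimilar P) {a b : ℝ} (hab : a ≤ b)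
    (hs : 4 / 5 ≤ a + b) :
    1 / 225 + (1 / 10 - a) ^ 2 ≤ ∫ x, minSq {a, b} (S 0 x) ∂P := by
  have := hP.le_integral_sq (continuous_minSq_S {a, b} 0) (1 / 5) (-a) 0 0
    fun x hx0 hx1 => by
      refine le_trans (le_of_eq ?_) (sub_sq_le_minSq_pair_left hab (by rw [S_zero]; linarith))
      rw [S_zero]; ring
  linarith

/-- The integral over `J₃` when it is served by `b`. -/
theorem IsSelfSimilar.le_integral_pair_two (hP : IsSelfSimilar P) {a b : ℝ} (hab : a ≤ b)
    (hs : a + b ≤ 1) :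
    1 / 225 + (9 / 10 - b) ^ 2 ≤ ∫ x, minSq {a, b} (S 2 x) ∂P := by
  have := hP.le_integral_sq (continuous_minSq_S {a, b} 2) (1 / 5) (4 / 5 - b) 0 0
    fun x hx0 hx1 => by
      refine le_trans (le_of_eq ?_) (sub_sq_le_minSq_pair_right hab (by rw [S_two]; linarith))
      rw [S_two]; ring
  linarith

theorem IsSelfSimilar.le_integral_pair_one_of_le (hP : IsSelfSimilar P) {a b : ℝ} (hab : a ≤ b)
    (hs : a + b ≤ 4 / 5) :
    1 / 225 + (1 / 2 - b) ^ 2 ≤ ∫ x, minSq {a, b} (S 1 x) ∂P := by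
  have := hP.le_integral_sq (continuous_minSq_S {a, b} 1) (1 / 5) (2 / 5 - b) 0 0
    fun x hx0 hx1 => by
      refine le_trans (le_of_eq ?_) (sub_sq_le_minSq_pair_right hab (by rw [S_one]; linarith))
      rw [S_one]; ring
  linarith

/-- The integral over `J₂₁` when it is served by `a`. -/
theorem IsSelfSimilar.le_integral_pair_one_zero (hP : IsSelfSimilar P) {a b : ℝ} (hab : a ≤ b)
    (hs : 22 / 25 ≤ a + b) :
    1 / 5625 + (21 / 50 - a) ^ 2 ≤ ∫ x, minSq {a, b} (S 1 (S 0 x)) ∂P := by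
  have := hP.le_integral_sq (continuous_minSq_S_S {a, b} 1 0) (1 / 25) (2 / 5 - a) 0 0
    fun x hx0 hx1 => by
      refine le_trans (le_of_eq ?_)
        (sub_sq_le_minSq_pair_left hab (by rw [S_one, S_zero]; linarith))
      rw [S_one, S_zero]; ring
  linarith

/-- The integral over `J₂₁` when the midpoint of `a` and `b` lies in `J₂₁`. -/
theorem IsSelfSimilar.le_integral_pair_one_zero_of_le (hP : IsSelfSimilar P) {a b : ℝ}
    (hab : a ≤ b) (hs1 : 4 / 5 ≤ a + b) (hs : a + b ≤ 22 / 25) :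
    1 / 5625 + (21 / 50 - a) ^ 2 - (b - a) * (22 / 25 - (a + b)) / 2 ≤
      ∫ x, minSq {a, b} (S 1 (S 0 x)) ∂P := by
  have := hP.le_integral_sq (continuous_minSq_S_S {a, b} 1 0) (1 / 25) (2 / 5 - a) 0
    (-((b - a) * (22 / 25 - (a + b)))) fun x hx0 hx1 => by
      -- The saving of b over a is (b - a) max(0, 2y - a - b) at a point y of J₂₁. It is convex in
      -- y, hence below its chord, which gives the mean factor 1/2.
      have hm := mul_nonneg (mul_nonneg (sub_nonneg.2 hab) (sub_nonneg.2 hs)) hx0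
      have hm2 := mul_nonneg (mul_nonneg (sub_nonneg.2 hab) (sub_nonneg.2 hs1))
        (sub_nonneg.2 hx1)
      rw [S_one, S_zero]
      exact le_minSq_pair (by linarith) (by linarith)
  linarith

/-- The integral over `J₂₂` when it is served by `b`. -/
theorem IsSelfSimilar.le_integral_pair_one_one (hP : IsSelfSimilar P) {a b : ℝ} (hab : a ≤ b)
    (hs : a + b ≤ 24 / 25) :
    1 / 5625 + (1 / 2 - b) ^ 2 ≤ ∫ x, minSq {a, b} (S 1 (S 1 x)) ∂P := by
  have := hP.le_integral_sq (continuous_minSq_S_S {a, b} 1 1) (1 / 25) (12 / 25 - b) 0 0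
    fun x hx0 hx1 => by
      refine le_trans (le_of_eq ?_)
        (sub_sq_le_minSq_pair_right hab (by rw [S_one, S_one]; linarith))
      rw [S_one, S_one]; ring
  linarith

/-- The integral over `J₂₂` when the midpoint of `a` and `b` lies in the left half of `J₂₂`. -/
theorem IsSelfSimilar.le_integral_pair_one_one_of_le (hP : IsSelfSimilar P) {a b : ℝ}
    (hab : a ≤ b) (hs1 : 24 / 25 ≤ a + b) (hs : a + b ≤ 1) :
    1 / 5625 + (1 / 2 - b) ^ 2 - 3 / 10 * ((b - a) * (a + b - 24 / 25)) ≤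
      ∫ x, minSq {a, b} (S 1 (S 1 x)) ∂P := by
  have c3 (j : Fin 3) : Continuous fun x => minSq {a, b} (S 1 (S 1 (S j x))) :=
    (continuous_minSq_S_S {a, b} 1 1).comp (continuous_S j)
  rw [hP.integral_eq (continuous_minSq_S_S {a, b} 1 1)]
  have hm := mul_nonneg (sub_nonneg.2 hab) (sub_nonneg.2 hs1)
  have hm' := mul_nonneg (sub_nonneg.2 hab) (sub_nonneg.2 hs)
  -- Put D = a + b - 24/25 ≤ 1/25. The saving of a over b is bounded by (b - a) D times 1 - 2x/5, (1
  -- - x)/5 and 0 on the three subpieces. The means 4/5, 1/10, 0 average to 3/10.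
  have h0 := hP.le_integral_sq (c3 0) (1 / 125) (12 / 25 - b)
    ((b - a) * (a + b - 24 / 25)) (2 / 5 * ((b - a) * (a + b - 24 / 25))) fun x hx0 hx1 => by
      have hmx := mul_nonneg hm hx0
      have hmx' := mul_nonneg hm' hx0
      have hmy := mul_nonneg hm (sub_nonneg.2 hx1)
      rw [S_one, S_one, S_zero]
      exact le_minSq_pair (by linarith) (by linarith)
  have h1 := hP.le_integral_sq (c3 1) (1 / 125) (62 / 125 - b)
    (1 / 5 * ((b - a) * (a + b - 24 / 25))) (1 / 5 * ((b - a) * (a + b - 24 / 25)))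
    fun x hx0 hx1 => by
      have hmx := mul_nonneg (sub_nonneg.2 hab) hx0
      have hmx' := mul_nonneg hm' hx0
      have hmy := mul_nonneg hm (sub_nonneg.2 hx1)
      have hmy' := mul_nonneg hm' (sub_nonneg.2 hx1)
      rw [S_one, S_one, S_one]
      exact le_minSq_pair (by linarith) (by linarith)
  have h2 := hP.le_integral_sq (c3 2) (1 / 125) (64 / 125 - b) 0 0 fun x hx0 hx1 => by
    refine le_trans (le_of_eq ?_)
      (sub_sq_le_minSq_pair_right hab (by rw [S_one, S_one, S_two]; linarith))
    rw [S_one, S_one, S_two]; ring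
  linarith

/-- The integral over `J₂₃` when it is served by `b`. -/
theorem IsSelfSimilar.le_integral_pair_one_two (hP : IsSelfSimilar P) {a b : ℝ} (hab : a ≤ b)
    (hs : a + b ≤ 1) :
    1 / 5625 + (29 / 50 - b) ^ 2 ≤ ∫ x, minSq {a, b} (S 1 (S 2 x)) ∂P := by
  have := hP.le_integral_sq (continuous_minSq_S_S {a, b} 1 2) (1 / 25) (14 / 25 - b) 0 0
    fun x hx0 hx1 => by
      refine le_trans (le_of_eq ?_)
        (sub_sq_le_minSq_pair_right hab (by rw [S_one, S_two]; linarith))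
      rw [S_one, S_two]; ring
  linarith

theorem IsSelfSimilar.distortion_pair_of_le (hP : IsSelfSimilar P) {a b : ℝ} (hab : a ≤ b)
    (hs : a + b ≤ 1) : 821 / 28125 ≤ distortion P {a, b} := by
  rw [hP.distortion_eq_thirds]
  have h2 := hP.le_integral_pair_two hab hs
  rcases le_total (a + b) (4 / 5) with s1 | s1
  · have h0 := integral_minSq_S_nonneg (P := P) {a, b} 0
    have h1 := hP.le_integral_pair_one_of_le hab s1
    linarith [sq_nonneg (b - 7 / 10)]
  have h0 := hP.le_integral_pair_zero hab s1
  rw [hP.integral_eq (continuous_minSq_S {a, b} 1)]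
  have h12 := hP.le_integral_pair_one_two hab hs
  rcases le_total (a + b) (24 / 25) with s2 | s2
  · have h11 := hP.le_integral_pair_one_one hab s2
    rcases le_total (a + b) (22 / 25) with s3 | s3
    · have h10 := hP.le_integral_pair_one_zero_of_le hab s1 s3
      -- In each case the bound is a separable quadratic in a and b; the squares are centred at its
      -- minimizer. Only in the next case is this the optimal pair.
      linarith [sq_nonneg (a - 1 / 7), sq_nonneg (b - 8 / 11)]
    · have h10 := hP.le_integral_pair_one_zero hab s3
      linarith [sq_nonneg (a - 9 / 50), sq_nonneg (b - 189 / 250)]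
  · have h10 := hP.le_integral_pair_one_zero (b := b) hab (by linarith)
    have h11 := hP.le_integral_pair_one_one_of_le hab s2 hs
    linarith [sq_nonneg (a - 216 / 1075), sq_nonneg (b - 909 / 1175)]

theorem IsSelfSimilar.distortion_pair (hP : IsSelfSimilar P) (a b : ℝ) :
    821 / 28125 ≤ distortion P {a, b} := by
  wlog hab : a ≤ b generalizing a b
  · rw [Finset.pair_comm]
    exact this b a (le_of_not_ge hab)
  rcases le_total (a + b) 1 with hs | hs
  · exact hP.distortion_pair_of_le hab hs
  · have := isProbabilityMeasure_reflect (P := P)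
    have hr := hP.reflect.distortion_pair_of_le (a := 1 - b) (b := 1 - a) (by linarith)
      (by linarith)
    rw [← distortion_reflect (by simp)]
    rw [Finset.image_insert, Finset.image_singleton, Finset.pair_comm]
    exact hr

/-! ### The lower bound in general -/

theorem IsSelfSimilar.optError_le_or (hP : IsSelfSimilar P) {α β : Finset ℝ}
    (hβ : β.Nonempty) (hsub : β ⊆ α) (h : ∀ a ∈ α, a ∈ β ∨ a ≤ -1 / 2 ∨ 3 / 2 ≤ a)
    (hle : optError β.card ≤ distortion P β) :
    optError β.card ≤ distortion P α ∨
      (β.card = 1 ∧ optError β.card - 1 / 288 ≤ distortion P α ∧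
        ∃ q ∈ α, q ∉ β ∧ ((3 / 2 ≤ q ∧ q ≤ 13 / 8) ∨ (-5 / 8 ≤ q ∧ q ≤ -1 / 2))) := by
  rcases (by have := hβ.card_pos; omega : β.card = 1 ∨ 2 ≤ β.card) with h1 | h1
  · obtain ⟨p, rfl⟩ := Finset.card_eq_one.1 h1
    rw [h1, optError_one]
    simp only [Finset.mem_singleton] at h ⊢
    exact (hP.distortion_one (Finset.singleton_subset_iff.1 hsub) h).imp_right fun h => ⟨trivial, h⟩
  · left
    refine hP.distortion_ge_of_subset hβ hsub h ?_ hle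
    refine (optError_anti (by norm_num) h1).trans ?_
    rw [optError_two]
    norm_num

/-- A point q ≤ -3/8 is wasted. A partner p ≤ 1/2 leaves the right third unserved, and p ≥ 1/2
leaves the left third unserved. -/
theorem IsSelfSimilar.optError_add_le_of_near_left (hP : IsSelfSimilar P) {α β : Finset ℝ}
    (hsub : β ⊆ α) (h : ∀ a ∈ α, a ∈ β ∨ a ≤ -1 / 2 ∨ 3 / 2 ≤ a) (hc : β.card ≤ 2)
    {q : ℝ} (hq : q ∈ β) (hq' : q ≤ -3 / 8) :
    optError β.card + 1 / 125 ≤ distortion P α := by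
  have hα : α.Nonempty := ⟨q, hsub hq⟩
  rcases (by have := Finset.card_pos.2 ⟨q, hq⟩; omega : β.card = 1 ∨ β.card = 2) with h1 | h1
  · rw [h1, optError_one]
    obtain ⟨p, rfl⟩ := Finset.card_eq_one.1 h1
    obtain rfl := Finset.mem_singleton.1 hq
    have := hP.distortion_ge_of_far hα (u := 3 / 8) (by norm_num) fun a ha => by
      rcases h a ha with h | h | h
      · rw [Finset.mem_singleton.1 h]
        exact Or.inl (by linarith)
      · exact Or.inl (by linarith)
      · exact Or.inr (by linarith)
    linarith
  · rw [h1, optError_two]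
    obtain ⟨p, hp⟩ := Finset.card_eq_one.1
      (show (β.erase q).card = 1 by rw [Finset.card_erase_of_mem hq, h1])
    have hmem : ∀ a ∈ β, a = q ∨ a = p := fun a ha => by
      by_cases haq : a = q
      · exact Or.inl haq
      · exact Or.inr (Finset.mem_singleton.1 (hp ▸ Finset.mem_erase.2 ⟨haq, ha⟩))
    rcases le_total p (1 / 2) with hp2 | hp2
    · have := hP.distortion_ge_of_far_right hα fun a ha => by
        rcases h a ha with h | h | h
        · rcases hmem a h with rfl | rfl
          · exact Or.inl (by linarith)
          · exact Or.inl hp2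
        · exact Or.inl (by linarith)
        · exact Or.inr h
      linarith
    · refine hP.distortion_ge_of_two hα fun a ha => ?_
      rcases h a ha with h | h | h
      · rcases hmem a h with rfl | rfl
        · exact Or.inl hq'
        · exact Or.inr hp2
      · exact Or.inl (by linarith)
      · exact Or.inr (by linarith)

theorem reflect_injective : Function.Injective fun y : ℝ => 1 - y := fun x y h => by
  simpa using h

theorem IsSelfSimilar.optError_add_le_of_near (hP : IsSelfSimilar P) {α β : Finset ℝ}
    (hsub : β ⊆ α) (h : ∀ a ∈ α, a ∈ β ∨ a ≤ -1 / 2 ∨ 3 / 2 ≤ a) (hc : β.card ≤ 2)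
    {q : ℝ} (hq : q ∈ β) (hq' : q ≤ -3 / 8 ∨ 11 / 8 ≤ q) :
    optError β.card + 1 / 125 ≤ distortion P α := by
  rcases hq' with hq' | hq'
  · exact hP.optError_add_le_of_near_left hsub h hc hq hq'
  · have := isProbabilityMeasure_reflect (P := P)
    have hcard := Finset.card_image_of_injective β reflect_injective
    rw [← distortion_reflect ⟨q, hsub hq⟩, ← hcard]
    refine hP.reflect.optError_add_le_of_near_left (Finset.image_subset_image hsub)
      (forall_mem_reflect.2 fun a ha => ?_) (hcard.trans_le hc) (Finset.mem_image_of_mem _ hq)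
      (by linarith)
    rcases h a ha with h | h | h
    · exact Or.inl (Finset.mem_image_of_mem _ h)
    · exact Or.inr (Or.inr (by linarith))
    · exact Or.inr (Or.inl (by linarith))

theorem optError_sum_le {m : Fin 3 → ℕ} (hm : ∀ i, 1 ≤ m i) :
    75 * optError (∑ i, m i) ≤ ∑ i, optError (m i) := by
  simp only [Fin.sum_univ_three]
  exact optError_add_le (hm 0) (hm 1) (hm 2)

theorem optError_sum_add_le {m : Fin 3 → ℕ} (hm : ∀ i, 1 ≤ m i) {i j : Fin 3} (hi : m i = 1)
    (hj : 3 ≤ m j) : 75 * optError (∑ i, m i) + 1 / 20 ≤ ∑ i, optError (m i) := by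
  -- The regrouping is stated for all additive commutative monoids because it is used in both ℕ and
  -- ℝ.
  obtain ⟨k, hij, hk⟩ : ∃ k : Fin 3, i ≠ j ∧ k ≠ i ∧ k ≠ j ∧
      ∀ (M : Type) [AddCommMonoid M] (f : Fin 3 → M), ∑ i, f i = f i + f j + f k := by
    have hij : i ≠ j := by rintro rfl; omega
    have hex : ∀ i j : Fin 3, i ≠ j → ∃ k : Fin 3, k ≠ i ∧ k ≠ j := by decide
    obtain ⟨k, hki, hkj⟩ := hex i j hij
    refine ⟨k, hij, hki, hkj, fun M _ f => ?_⟩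
    have huniv : (Finset.univ : Finset (Fin 3)) = {i, j, k} := by
      symm
      rw [← Finset.card_eq_iff_eq_univ, Finset.card_eq_three.2 ⟨i, j, k, hij, hki.symm, hkj.symm, rfl⟩]
      rfl
    rw [huniv, Finset.sum_insert (by simp [hij, hki.symm]), Finset.sum_pair hkj.symm, add_assoc]
  rw [hk.2.2, hk.2.2, hi]
  exact optError_one_add_le hj (hm k)

/-- The piece of the Cantor set to which a point of the line is attributed. -/
noncomputable def owner (a : ℝ) : Fin 3 := if a < 3 / 10 then 0 else if a < 7 / 10 then 1 else 2

theorem Sinv_zero (a : ℝ) : Sinv 0 a = 5 * a := by simp [Sinv]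
theorem Sinv_one (a : ℝ) : Sinv 1 a = 5 * a - 2 := by simp [Sinv]; ring
theorem Sinv_two (a : ℝ) : Sinv 2 a = 5 * a - 4 := by simp [Sinv]; ring

theorem Sinv_far {a : ℝ} {i : Fin 3} (h : owner a ≠ i) :
    Sinv i a ≤ -1 / 2 ∨ 3 / 2 ≤ Sinv i a := by
  unfold owner at h
  match i with
  | 0 =>
    rw [Sinv_zero]
    split_ifs at h with h1 h2 <;> first | exact absurd rfl h | exact Or.inr (by linarith)
  | 1 =>
    rw [Sinv_one]
    split_ifs at h with h1 h2
    · exact Or.inl (by linarith)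
    · exact absurd rfl h
    · exact Or.inr (by linarith)
  | 2 =>
    rw [Sinv_two]
    split_ifs at h with h1 h2 <;> first | exact absurd rfl h | exact Or.inl (by linarith)

/-- Rescaled coordinates of adjacent pieces differ by 2, so being within 1/8 of the cut from one
side means being at least 3/8 outside the owning piece. -/
theorem Sinv_near {a : ℝ} {i : Fin 3} (h : owner a ≠ i)
    (h' : (3 / 2 ≤ Sinv i a ∧ Sinv i a ≤ 13 / 8) ∨ (-5 / 8 ≤ Sinv i a ∧ Sinv i a ≤ -1 / 2)) :
    Sinv (owner a) a ≤ -3 / 8 ∨ 11 / 8 ≤ Sinv (owner a) a := by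
  unfold owner at h ⊢
  match i with
  | 0 =>
    rw [Sinv_zero] at h'
    split_ifs at h ⊢ with h1 h2
    · exact absurd rfl h
    · rw [Sinv_one]
      exact Or.inl (by rcases h' with h' | h' <;> linarith)
    · rcases h' with h' | h' <;> linarith
  | 1 =>
    rw [Sinv_one] at h'
    split_ifs at h ⊢ with h1 h2
    · rw [Sinv_zero]
      exact Or.inr (by rcases h' with h' | h' <;> linarith)
    · exact absurd rfl h
    · rw [Sinv_two]
      exact Or.inl (by rcases h' with h' | h' <;> linarith)
  | 2 =>
    rw [Sinv_two] at h'
    split_ifs at h ⊢ with h1 h2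
    · rcases h' with h' | h' <;> linarith
    · rw [Sinv_one]
      exact Or.inr (by rcases h' with h' | h' <;> linarith)
    · exact absurd rfl h

theorem IsSelfSimilar.optError_le_of_forall_owned (hP : IsSelfSimilar P) {α : Finset ℝ}
    (hne : ∀ i, (α.filter fun a => owner a = i).Nonempty)
    (ih : ∀ i, optError ((α.filter fun a => owner a = i).image (Sinv i)).card ≤
      distortion P ((α.filter fun a => owner a = i).image (Sinv i))) :
    75 * optError α.card ≤ ∑ i, distortion P (α.image (Sinv i)) := by
  set β : Fin 3 → Finset ℝ := fun i => (α.filter fun a => owner a = i).image (Sinv i) with hβ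
  have hsub (i) : β i ⊆ α.image (Sinv i) := Finset.image_subset_image (Finset.filter_subset _ _)
  have hβne (i) : (β i).Nonempty := (hne i).image _
  have hcard : α.card = ∑ i, (β i).card := by
    rw [Finset.card_eq_sum_card_fiberwise (f := owner) (t := Finset.univ) (by simp [Set.MapsTo])]
    exact Finset.sum_congr rfl fun i _ =>
      (Finset.card_image_of_injective _ (Sinv_injective i)).symm
  have hfar (i) : ∀ x ∈ α.image (Sinv i), x ∈ β i ∨ x ≤ -1 / 2 ∨ 3 / 2 ≤ x := by
    intro x hx
    obtain ⟨a, ha, rfl⟩ := Finset.mem_image.1 hx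
    by_cases ho : owner a = i
    · exact Or.inl (Finset.mem_image_of_mem _ (Finset.mem_filter.2 ⟨ha, ho⟩))
    · exact Or.inr (Sinv_far ho)
  have hm (i) : 1 ≤ (β i).card := (hβne i).card_pos
  have hor (i) := hP.optError_le_or (hβne i) (hsub i) (hfar i) (ih i)
  rw [hcard]
  by_cases hall : ∀ i, optError (β i).card ≤ distortion P (α.image (Sinv i))
  · exact (optError_sum_le hm).trans (Finset.sum_le_sum fun i _ => hall i)
  push Not at hall
  obtain ⟨i, hi⟩ := hall
  obtain ⟨hi1, -, q, hq, hqβ, hqn⟩ := (hor i).resolve_left (not_le.2 hi)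
  obtain ⟨a, ha, rfl⟩ := Finset.mem_image.1 hq
  have ho : owner a ≠ i := fun ho =>
    hqβ (Finset.mem_image_of_mem _ (Finset.mem_filter.2 ⟨ha, ho⟩))
  have hweak (j) : optError (β j).card - 1 / 288 ≤ distortion P (α.image (Sinv j)) := by
    rcases hor j with h | h
    · linarith
    · exact h.2.1
  rcases Nat.lt_or_ge 2 (β (owner a)).card with h3 | h3
  -- Uneven splitting: the slack 1/20 absorbs three deficits of 1/288.
  · have h := optError_sum_add_le hm hi1 h3
    have hs := Finset.sum_le_sum fun j (_ : j ∈ Finset.univ) => hweak j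
    simp only [Fin.sum_univ_three] at h hs ⊢
    linarith
  -- The owner's surplus 1/125 absorbs the deficits 1/288 of the other two pieces.
  · have hex := hP.optError_add_le_of_near (hsub _) (hfar _) h3
      (Finset.mem_image_of_mem _ (Finset.mem_filter.2 ⟨ha, rfl⟩)) (Sinv_near ho hqn)
    have h := optError_sum_le hm
    have hs := Finset.sum_le_sum fun j (_ : j ∈ Finset.univ.erase (owner a)) => hweak j
    rw [Finset.sum_sub_distrib, Finset.sum_const, Finset.card_erase_of_mem (Finset.mem_univ _)] at hs
    have e1 := Finset.add_sum_erase Finset.univ (fun j => optError (β j).card)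
      (Finset.mem_univ (owner a))
    have e2 := Finset.add_sum_erase Finset.univ (fun j => distortion P (α.image (Sinv j)))
      (Finset.mem_univ (owner a))
    simp at hs
    linarith

theorem IsSelfSimilar.optError_card_le (hP : IsSelfSimilar P) {α : Finset ℝ}
    (hα : α.Nonempty) : optError α.card ≤ distortion P α := by
  induction hn : α.card using Nat.strong_induction_on generalizing α with
  | _ n ih =>
    have hpos := hα.card_pos
    rcases (by omega : n = 1 ∨ n = 2 ∨ 3 ≤ n) with rfl | rfl | h3
    · obtain ⟨a, rfl⟩ := Finset.card_eq_one.1 hn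
      rw [hP.distortion_singleton, optError_one]
      linarith [sq_nonneg (1 / 2 - a)]
    · obtain ⟨a, b, -, rfl⟩ := Finset.card_eq_two.1 hn
      rw [optError_two]
      exact hP.distortion_pair a b
    rw [hP.distortion_split hα, le_div_iff₀ (by norm_num), mul_comm, ← hn]
    by_cases hne : ∀ i, (α.filter fun a => owner a = i).Nonempty
    · have := hP.optError_le_of_forall_owned hne fun i => by
        refine ih _ ?_ ((hne i).image _) rfl
        rw [Finset.card_image_of_injective _ (Sinv_injective i), ← hn]
        -- Another piece owns a point too, so piece i owns strictly fewer than n points and the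
        -- induction hypothesis applies.
        obtain ⟨j, hj⟩ : ∃ j : Fin 3, j ≠ i := exists_ne i
        obtain ⟨a, ha⟩ := hne j
        rw [Finset.mem_filter] at ha
        exact Finset.card_lt_card (Finset.filter_ssubset.2 ⟨a, ha.1, by rw [ha.2]; exact hj⟩)
      rwa [Fin.sum_univ_three] at this
    · push Not at hne
      obtain ⟨i, hi⟩ := hne
      -- A piece without own points costs at least 131/300 > 1/3 = 75 E(3) ≥ 75 E(n).
      have hfar := hP.distortion_ge_of_far (hα.image (Sinv i)) (u := 1 / 2) (by norm_num)
        fun x hx => by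
          obtain ⟨a, ha, rfl⟩ := Finset.mem_image.1 hx
          refine (Sinv_far (a := a) (i := i) fun ho => ?_).imp
            (fun h => by linarith) (fun h => by linarith)
          exact absurd hi (Finset.Nonempty.ne_empty ⟨a, Finset.mem_filter.2 ⟨ha, ho⟩⟩)
      have hE : optError α.card ≤ 1 / 225 := by
        rw [← optError_three]
        exact optError_anti (by norm_num) (by omega)
      have hnn (j : Fin 3) : 0 ≤ distortion P (α.image (Sinv j)) :=
        integral_nonneg fun x => minSq_nonneg _ x
      have hsum : distortion P (α.image (Sinv i)) ≤ ∑ j, distortion P (α.image (Sinv j)) :=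
        Finset.single_le_sum (fun j _ => hnn j) (Finset.mem_univ i)
      rw [Fin.sum_univ_three] at hsum
      linarith

/-! ### Cylinder sets and their centroids -/

theorem continuous_Sw (σ : List (Fin 3)) : Continuous (Sw σ) := by
  induction σ with
  | nil => exact continuous_id
  | cons j σ ih => exact (continuous_S j).comp ih

theorem Sw_eq (σ : List (Fin 3)) (x : ℝ) : Sw σ x = 1 / 5 ^ σ.length * x + Sw σ 0 := by
  induction σ with
  | nil => simp [Sw]
  | cons j σ ih =>
    simp only [Sw, S, List.length_cons, pow_succ]
    rw [ih]
    field_simp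
    ring

theorem J_subset (σ : List (Fin 3)) : J σ ⊆ Set.Icc (Sw σ 0) (Sw σ 1) := by
  rintro _ ⟨x, hx, rfl⟩
  have h : (0 : ℝ) < 1 / 5 ^ σ.length := by positivity
  rw [Sw_eq σ x, Sw_eq σ 1]
  constructor <;> nlinarith [hx.1, hx.2]

theorem Sw_mem_Icc (σ : List (Fin 3)) {x : ℝ} (hx : x ∈ Set.Icc (0 : ℝ) 1) :
    Sw σ x ∈ Set.Icc (0 : ℝ) 1 := by
  induction σ with
  | nil => exact hx
  | cons j σ ih =>
    have h0 : (0 : ℝ) ≤ ((j : ℕ) : ℝ) := by positivity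
    have h2 := val_le_two j
    simp only [Sw, S, Set.mem_Icc] at ih ⊢
    constructor <;> linarith

theorem J_cons (j : Fin 3) (σ : List (Fin 3)) : J (j :: σ) = S j '' J σ := by
  rw [J, J, Set.image_image]
  rfl

theorem measurableSet_J (σ : List (Fin 3)) : MeasurableSet (J σ) :=
  (isCompact_Icc.image (continuous_Sw σ)).measurableSet

theorem S_injective (j : Fin 3) : Function.Injective (S j) := fun x y h => by
  simp only [S] at h
  linarith

theorem S_eq_S {i j : Fin 3} {x y : ℝ} (hx : x ∈ Set.Icc (0 : ℝ) 1) (hy : y ∈ Set.Icc (0 : ℝ) 1)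
    (h : S i x = S j y) : i = j := by
  simp only [S] at h
  have h1 : ((i : ℕ) : ℝ) < (j : ℕ) + 1 := by linarith [hx.1, hy.2]
  have h2 : ((j : ℕ) : ℝ) < (i : ℕ) + 1 := by linarith [hx.2, hy.1]
  have h1' : (i : ℕ) < j + 1 := by exact_mod_cast h1
  have h2' : (j : ℕ) < i + 1 := by exact_mod_cast h2
  exact Fin.ext (by omega)

/-- P lives on [0,1] and the images S_i([0,1]) are disjoint, so only the j-th term of the
self-similarity identity survives. -/
theorem IsSelfSimilar.measure_inter_J_cons (hP : IsSelfSimilar P) (j : Fin 3)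
    (σ : List (Fin 3)) {B : Set ℝ} (hB : MeasurableSet B) :
    P (B ∩ J (j :: σ)) = 3⁻¹ * P (S j ⁻¹' B ∩ J σ) := by
  have hself : S j ⁻¹' (B ∩ J (j :: σ)) = S j ⁻¹' B ∩ J σ := by
    rw [Set.preimage_inter, J_cons, Set.preimage_image_eq _ (S_injective j)]
  have hother (i : Fin 3) (hij : i ≠ j) : P (S i ⁻¹' (B ∩ J (j :: σ))) = 0 := by
    have hnull : P {x | x ∉ Set.Icc (0 : ℝ) 1} = 0 := ae_iff.1 hP.ae_mem_Icc
    refine measure_mono_null (fun x hx => ?_) hnull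
    refine fun hxI => hij ?_
    obtain ⟨-, hx⟩ := hx
    rw [J_cons] at hx
    obtain ⟨_, ⟨y, hy, rfl⟩, hxy⟩ := hx
    exact (S_eq_S (Sw_mem_Icc σ hy) hxI hxy).symm
  rw [hP.apply (hB.inter (measurableSet_J _))]
  have hsum : P (S 0 ⁻¹' (B ∩ J (j :: σ))) + P (S 1 ⁻¹' (B ∩ J (j :: σ))) +
      P (S 2 ⁻¹' (B ∩ J (j :: σ))) = ∑ i, P (S i ⁻¹' (B ∩ J (j :: σ))) :=
    (Fin.sum_univ_three fun i => P (S i ⁻¹' (B ∩ J (j :: σ)))).symm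
  rw [hsum, Finset.sum_eq_single j (fun i _ hij => hother i hij) (by simp), hself]

theorem IsSelfSimilar.restrict_J (hP : IsSelfSimilar P) (σ : List (Fin 3)) :
    P.restrict (J σ) = (3⁻¹ : ENNReal) ^ σ.length • P.map (Sw σ) := by
  induction σ with
  | nil =>
    have h1 : J [] = Set.Icc 0 1 := Set.image_id _
    have h2 : Sw [] = id := rfl
    simp [h1, h2, hP.restrict_Icc]
  | cons j σ ih =>
    ext B hB
    have hB' : MeasurableSet (S j ⁻¹' B) := measurable_S j hB
    rw [Measure.restrict_apply hB, hP.measure_inter_J_cons j σ hB,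
      ← Measure.restrict_apply hB', ih, Measure.smul_apply, Measure.smul_apply,
      Measure.map_apply (continuous_Sw σ).measurable hB',
      Measure.map_apply (continuous_Sw _).measurable hB, List.length_cons, pow_succ']
    simp only [smul_eq_mul, mul_assoc]
    rfl

theorem IsSelfSimilar.real_J (hP : IsSelfSimilar P) (σ : List (Fin 3)) :
    P.real (J σ) = (1 / 3) ^ σ.length := by
  have h : P (J σ) = (3⁻¹ : ENNReal) ^ σ.length := by
    rw [← Measure.restrict_apply_univ, hP.restrict_J, Measure.smul_apply,
      Measure.map_apply (continuous_Sw σ).measurable MeasurableSet.univ]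
    simp
  rw [Measure.real, h]
  simp

theorem IsSelfSimilar.integral_Sw (hP : IsSelfSimilar P) (σ : List (Fin 3)) :
    ∫ x, Sw σ x ∂P = Sw σ (1 / 2) := by
  have h : ∀ x, Sw σ x = Sw σ 0 + 1 / 5 ^ σ.length * x + 0 * x ^ 2 := fun x => by
    rw [Sw_eq σ x]; ring
  rw [integral_congr_ae (Filter.Eventually.of_forall h), hP.integral_quadratic, Sw_eq σ (1 / 2)]
  ring

theorem IsSelfSimilar.setIntegral_J (hP : IsSelfSimilar P) (σ : List (Fin 3)) :
    ∫ x in J σ, x ∂P = (1 / 3) ^ σ.length * Sw σ (1 / 2) := by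
  rw [hP.restrict_J, integral_smul_measure,
    integral_map (f := fun x : ℝ => x) (continuous_Sw σ).aemeasurable (by fun_prop),
    hP.integral_Sw]
  simp

theorem IsSelfSimilar.centroid_singleton (hP : IsSelfSimilar P) (σ : List (Fin 3)) :
    centroid P [σ] = Sw σ (1 / 2) := by
  have h : JU [σ] = J σ := by simp [JU]
  rw [centroid, h, hP.real_J, hP.setIntegral_J]
  field_simp

theorem JU_cons (σ : List (Fin 3)) (L : List (List (Fin 3))) : JU (σ :: L) = J σ ∪ JU L := by
  simp [JU]

theorem JU_singleton (σ : List (Fin 3)) : JU [σ] = J σ := by simp [JU]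

theorem measurableSet_JU (L : List (List (Fin 3))) : MeasurableSet (JU L) := by
  induction L with
  | nil => simp [JU]
  | cons σ L ih => rw [JU_cons]; exact (measurableSet_J σ).union ih

theorem disjoint_J {σ τ : List (Fin 3)} (h : Sw σ 1 < Sw τ 0) : Disjoint (J σ) (J τ) :=
  Set.disjoint_left.2 fun _ hx hy =>
    absurd ((J_subset σ hx).2.trans_lt (h.trans_le (J_subset τ hy).1)) (lt_irrefl _)

theorem IsSelfSimilar.real_JU_cons (hP : IsSelfSimilar P) {σ : List (Fin 3)}
    {L : List (List (Fin 3))} (h : ∀ τ ∈ L, Sw σ 1 < Sw τ 0) :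
    P.real (JU (σ :: L)) = (1 / 3) ^ σ.length + P.real (JU L) ∧
      ∫ x in JU (σ :: L), x ∂P = (1 / 3) ^ σ.length * Sw σ (1 / 2) + ∫ x in JU L, x ∂P := by
  have hd : Disjoint (J σ) (JU L) := by
    rw [JU, Set.disjoint_iUnion₂_right]
    exact fun τ hτ => disjoint_J (h τ hτ)
  have hi : Integrable (fun x : ℝ => x) P := hP.integrable continuous_id
  rw [JU_cons, measureReal_union hd (measurableSet_JU L),
    setIntegral_union hd (measurableSet_JU L) hi.integrableOn hi.integrableOn, hP.real_J,
    hP.setIntegral_J]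
  exact ⟨rfl, rfl⟩

theorem IsSelfSimilar.alpha2_eq (hP : IsSelfSimilar P) : alpha2 P = {9 / 50, 189 / 250} := by
  have h1 := hP.real_JU_cons (σ := [0]) (L := [[1, 0]]) (by
    norm_num [Sw, S_zero, S_one])
  have h2 := hP.real_JU_cons (σ := [1, 1]) (L := [[1, 2], [2]]) (by
    norm_num [Sw, S_one, S_two])
  have h3 := hP.real_JU_cons (σ := [1, 2]) (L := [[2]]) (by
    norm_num [Sw, S_one, S_two])
  rw [JU_singleton, hP.real_J, hP.setIntegral_J] at h1 h3
  rw [h3.1, h3.2] at h2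
  norm_num [Sw, S_zero, S_one, S_two] at h1 h2
  rw [alpha2, centroid, centroid, h1.1, h1.2, h2.1, h2.2]
  norm_num

theorem IsSelfSimilar.alpha3_eq (hP : IsSelfSimilar P) :
    alpha3 P = {1 / 10, 1 / 2, 9 / 10} := by
  rw [alpha3, hP.centroid_singleton, hP.centroid_singleton, hP.centroid_singleton]
  norm_num [Sw, S_zero, S_one, S_two]

/-! ### Upper bounds -/

theorem IsSelfSimilar.integral_le_sq (hP : IsSelfSimilar P) {f : ℝ → ℝ} (hf : Continuous f)
    (r s : ℝ) (h : ∀ x, f x ≤ (r * x - s) ^ 2) :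
    ∫ x, f x ∂P ≤ r ^ 2 / 9 + (r / 2 - s) ^ 2 := by
  rw [← hP.integral_sub_sq]
  exact hP.integral_mono hf (by fun_prop) fun x _ _ => h x

theorem IsSelfSimilar.distortion_alpha2 (hP : IsSelfSimilar P) :
    distortion P (alpha2 P) = 821 / 28125 := by
  rw [hP.alpha2_eq]
  refine le_antisymm ?_ (hP.distortion_pair _ _)
  set α : Finset ℝ := {9 / 50, 189 / 250} with hα
  have ha (x : ℝ) : minSq α x ≤ (x - 9 / 50) ^ 2 := minSq_le (by simp [hα]) x
  have hb (x : ℝ) : minSq α x ≤ (x - 189 / 250) ^ 2 := minSq_le (by simp [hα]) x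
  rw [hP.distortion_eq_thirds, hP.integral_eq (continuous_minSq_S α 1)]
  have h0 := hP.integral_le_sq (continuous_minSq_S α 0) (1 / 5) (9 / 50)
    fun x => (ha _).trans_eq (by rw [S_zero]; ring)
  have h10 := hP.integral_le_sq (continuous_minSq_S_S α 1 0) (1 / 25) (9 / 50 - 2 / 5)
    fun x => (ha _).trans_eq (by rw [S_zero, S_one]; ring)
  have h11 := hP.integral_le_sq (continuous_minSq_S_S α 1 1) (1 / 25) (189 / 250 - 12 / 25)
    fun x => (hb _).trans_eq (by rw [S_one, S_one]; ring)
  have h12 := hP.integral_le_sq (continuous_minSq_S_S α 1 2) (1 / 25) (189 / 250 - 14 / 25)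
    fun x => (hb _).trans_eq (by rw [S_two, S_one]; ring)
  have h2 := hP.integral_le_sq (continuous_minSq_S α 2) (1 / 5) (189 / 250 - 4 / 5)
    fun x => (hb _).trans_eq (by rw [S_two]; ring)
  linarith

theorem IsSelfSimilar.distortion_alpha3 (hP : IsSelfSimilar P) :
    distortion P (alpha3 P) = 1 / 225 := by
  rw [hP.alpha3_eq]
  set α : Finset ℝ := {1 / 10, 1 / 2, 9 / 10} with hα
  have hm0 : (1 / 10 : ℝ) ∈ α := by simp [hα]
  have hm1 : (1 / 2 : ℝ) ∈ α := by simp [hα]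
  have hm2 : (9 / 10 : ℝ) ∈ α := by simp [hα]
  apply le_antisymm
  · rw [hP.distortion_eq_thirds]
    have h0 := hP.integral_le_sq (continuous_minSq_S α 0) (1 / 5) (1 / 10)
      fun x => (minSq_le hm0 _).trans_eq (by rw [S_zero]; ring)
    have h1 := hP.integral_le_sq (continuous_minSq_S α 1) (1 / 5) (1 / 2 - 2 / 5)
      fun x => (minSq_le hm1 _).trans_eq (by rw [S_one]; ring)
    have h2 := hP.integral_le_sq (continuous_minSq_S α 2) (1 / 5) (9 / 10 - 4 / 5)
      fun x => (minSq_le hm2 _).trans_eq (by rw [S_two]; ring)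
    linarith
  · have h := hP.optError_card_le ⟨_, hm0⟩
    have hc : α.card = 3 := by
      rw [Finset.card_eq_three]
      exact ⟨_, _, _, by norm_num, by norm_num, by norm_num, hα⟩
    rwa [hc, optError_three] at h

/-! ### Decomposition over the words of a given length -/

theorem IsSelfSimilar.integral_eq_sum_words (hP : IsSelfSimilar P) (l : ℕ) {f : ℝ → ℝ}
    (hf : Continuous f) :
    ∫ x, f x ∂P = (∑ ω : Fin l → Fin 3, ∫ x, f (Sw (List.ofFn ω) x) ∂P) / 3 ^ l := by
  induction l generalizing f with
  | zero => simp [Sw]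
  | succ l ih =>
    have hsum : ∑ ω : Fin (l + 1) → Fin 3, ∫ x, f (Sw (List.ofFn ω) x) ∂P =
        ∑ j : Fin 3, ∑ ω : Fin l → Fin 3, ∫ x, f (S j (Sw (List.ofFn ω) x)) ∂P := by
      rw [← Fintype.sum_prod_type']
      refine (Fintype.sum_equiv (Fin.consEquiv fun _ => Fin 3) _ _ fun p => ?_).symm
      simp [Fin.consEquiv, List.ofFn_succ, Sw]
    rw [hP.integral_eq hf, hsum, Fin.sum_univ_three,
      ih (f := fun x => f (S 0 x)) (hf.comp (continuous_S 0)),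
      ih (f := fun x => f (S 1 x)) (hf.comp (continuous_S 1)),
      ih (f := fun x => f (S 2 x)) (hf.comp (continuous_S 2)), pow_succ]
    field_simp

theorem minSq_Sw_le {α β : Finset ℝ} (hβ : β.Nonempty) {σ : List (Fin 3)}
    (h : β.image (Sw σ) ⊆ α) (x : ℝ) : minSq α (Sw σ x) ≤ minSq β x / 25 ^ σ.length := by
  rw [le_div_iff₀ (by positivity)]
  refine le_minSq hβ fun b hb => ?_
  have h1 := minSq_le (h (Finset.mem_image_of_mem _ hb)) (Sw σ x)
  have h2 : (Sw σ x - Sw σ b) ^ 2 * 25 ^ σ.length = (x - b) ^ 2 := by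
    rw [Sw_eq σ x, Sw_eq σ b, (by norm_num : (25 : ℝ) = 5 ^ 2), ← pow_mul, mul_comm 2, pow_mul]
    field_simp
    ring
  rw [← h2]
  gcongr

/-- Each cylinder has mass 3^(-l) and is served by its own copy of β ω at scale 25^(-l); using
nearer points elsewhere could only lower the cost. -/
theorem IsSelfSimilar.distortion_le_sum_words (hP : IsSelfSimilar P) {l : ℕ} {α : Finset ℝ}
    {β : (Fin l → Fin 3) → Finset ℝ} (hβ : ∀ ω, (β ω).Nonempty)
    (h : ∀ ω, (β ω).image (Sw (List.ofFn ω)) ⊆ α) :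
    distortion P α ≤ 1 / 75 ^ l * ∑ ω, distortion P (β ω) := by
  rw [distortion_eq, hP.integral_eq_sum_words l (continuous_minSq α)]
  have hle (ω : Fin l → Fin 3) :
      ∫ x, minSq α (Sw (List.ofFn ω) x) ∂P ≤ distortion P (β ω) / 25 ^ l := by
    rw [distortion_eq, ← integral_div]
    refine hP.integral_mono ((continuous_minSq α).comp (continuous_Sw _))
      ((continuous_minSq _).div_const _) fun x _ _ => ?_
    have := minSq_Sw_le (hβ ω) (h ω) x
    rwa [List.length_ofFn] at this
  calc _ ≤ (∑ ω, distortion P (β ω) / 25 ^ l) / 3 ^ l := by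
        gcongr with ω
        exact hle ω
    _ = _ := by
        rw [← Finset.sum_div, div_div, ← mul_pow]
        norm_num
        ring

/-- The union of the images of `A` and `B` under the words of length `l`, where `B` is used for
the words in `I`. -/
noncomputable def mixedSet {l : ℕ} (I : Finset (Fin l → Fin 3)) (A B : Finset ℝ) : Finset ℝ :=
  (Iᶜ).biUnion (fun ω => A.image (Sw (List.ofFn ω))) ∪
    I.biUnion (fun ω => B.image (Sw (List.ofFn ω)))

theorem card_mixedSet_le {l : ℕ} (I : Finset (Fin l → Fin 3)) (A B : Finset ℝ) :
    (mixedSet I A B).card ≤ (3 ^ l - I.card) * A.card + I.card * B.card := by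
  refine (Finset.card_union_le _ _).trans (add_le_add ?_ ?_)
  · refine (Finset.card_biUnion_le_card_mul _ _ A.card fun _ _ => Finset.card_image_le).trans_eq ?_
    rw [Finset.card_compl]
    simp
  · exact Finset.card_biUnion_le_card_mul _ _ B.card fun _ _ => Finset.card_image_le

theorem image_subset_mixedSet {l : ℕ} (I : Finset (Fin l → Fin 3)) (A B : Finset ℝ)
    (ω : Fin l → Fin 3) :
    (if ω ∈ I then B else A).image (Sw (List.ofFn ω)) ⊆ mixedSet I A B := by
  split_ifs with hω
  · exact (Finset.subset_biUnion_of_mem (fun ω => B.image (Sw (List.ofFn ω))) hω).trans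
      Finset.subset_union_right
  · exact (Finset.subset_biUnion_of_mem (fun ω => A.image (Sw (List.ofFn ω)))
      (Finset.mem_compl.2 hω)).trans Finset.subset_union_left

theorem IsSelfSimilar.distortion_mixedSet_le (hP : IsSelfSimilar P) {l : ℕ}
    (I : Finset (Fin l → Fin 3)) {A B : Finset ℝ} (hA : A.Nonempty) (hB : B.Nonempty) :
    distortion P (mixedSet I A B) ≤
      1 / 75 ^ l * ((3 ^ l - (I.card : ℝ)) * distortion P A + I.card * distortion P B) := by
  refine (hP.distortion_le_sum_words (β := fun ω => if ω ∈ I then B else A)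
    (fun ω => by split_ifs <;> assumption) (image_subset_mixedSet I A B)).trans_eq ?_
  have h (ω : Fin l → Fin 3) : distortion P (if ω ∈ I then B else A) =
      distortion P A + if ω ∈ I then distortion P B - distortion P A else 0 := by
    split_ifs <;> ring
  simp only [h, Finset.sum_add_distrib, Finset.sum_ite_mem, Finset.univ_inter, Finset.sum_const,
    Finset.card_univ, Fintype.card_fun, Fintype.card_fin, nsmul_eq_mul]
  push_cast
  ring

theorem mixedSet_nonempty {l : ℕ} (I : Finset (Fin l → Fin 3)) {A B : Finset ℝ}
    (hA : A.Nonempty) (hB : B.Nonempty) : (mixedSet I A B).Nonempty := by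
  refine Finset.Nonempty.mono (image_subset_mixedSet I A B fun _ => 0) (Finset.Nonempty.image ?_ _)
  split_ifs <;> assumption

/-- Upper and lower bounds meet: E is antitone on positive integers, so E(n) bounds every admissible
competitor and is a minimum as soon as one set attains it. -/
theorem IsSelfSimilar.isOptimal_of_le (hP : IsSelfSimilar P) {n : ℕ} {α : Finset ℝ}
    (hα : α.Nonempty) (hc : α.card ≤ n) (h : distortion P α ≤ optError n) :
    IsOptimal P n α ∧ distortion P α = optError n := by
  have hlow (β : Finset ℝ) (hβ : β.Nonempty) (hβn : β.card ≤ n) : optError n ≤ distortion P β :=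
    (optError_anti hβ.card_pos hβn).trans (hP.optError_card_le hβ)
  have he : distortion P α = optError n := le_antisymm h (hlow α hα hc)
  refine ⟨⟨hα, hc, ?_⟩, he⟩
  symm
  refine IsLeast.csInf_eq ⟨⟨α, hα, hc, rfl⟩, ?_⟩
  rintro _ ⟨β, hβ, hβn, rfl⟩
  rw [he]
  exact hlow β hβ hβn

/-- The centroid of J_ω is S_ω(1/2), so both cases of α_n(I) have the same mixed form. -/
theorem IsSelfSimilar.alphaSet_low (hP : IsSelfSimilar P) {l n : ℕ} (h : n ≤ 2 * 3 ^ l)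
    (I : Finset (Fin l → Fin 3)) : alphaSet P l n I = mixedSet I {1 / 2} (alpha2 P) := by
  rw [alphaSet, if_pos h, mixedSet]
  congr 1
  simp only [hP.centroid_singleton, Finset.image_singleton, Finset.biUnion_singleton]

theorem alphaSet_high {μ : Measure ℝ} {l n : ℕ} (h : 2 * 3 ^ l < n)
    (I : Finset (Fin l → Fin 3)) : alphaSet μ l n I = mixedSet I (alpha2 μ) (alpha3 μ) := by
  rw [alphaSet, if_neg (not_le.2 h), mixedSet]

theorem IsSelfSimilar.isOptimal_low (hP : IsSelfSimilar P) {l n : ℕ} (h1 : 3 ^ l ≤ n)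
    (h2 : n ≤ 2 * 3 ^ l) {I : Finset (Fin l → Fin 3)} (hI : I.card = n - 3 ^ l) :
    IsOptimal P n (alphaSet P l n I) ∧ distortion P (alphaSet P l n I) = optError n := by
  rw [hP.alphaSet_low h2]
  have hB : (alpha2 P).Nonempty := by simp [alpha2]
  refine hP.isOptimal_of_le (mixedSet_nonempty I (by simp) hB) ?_ ?_
  · refine (card_mixedSet_le I _ _).trans ?_
    have : (alpha2 P).card ≤ 2 := Finset.card_le_two
    have := Nat.mul_le_mul_left I.card this
    rw [Finset.card_singleton]
    omega
  · refine (hP.distortion_mixedSet_le I (by simp) hB).trans_eq ?_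
    rw [optError_low h1 h2, hP.distortion_alpha2, hP.distortion_singleton, hI,
      Nat.cast_sub h1]
    push_cast
    ring

theorem IsSelfSimilar.isOptimal_high (hP : IsSelfSimilar P) {l n : ℕ} (h1 : 2 * 3 ^ l < n)
    (h2 : n < 3 ^ (l + 1)) {I : Finset (Fin l → Fin 3)} (hI : I.card = n - 2 * 3 ^ l) :
    IsOptimal P n (alphaSet P l n I) ∧ distortion P (alphaSet P l n I) = optError n := by
  rw [alphaSet_high h1]
  have hA : (alpha2 P).Nonempty := by simp [alpha2]
  have hB : (alpha3 P).Nonempty := by simp [alpha3]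
  refine hP.isOptimal_of_le (mixedSet_nonempty I hA hB) ?_ ?_
  · refine (card_mixedSet_le I _ _).trans ?_
    have hA2 : (alpha2 P).card ≤ 2 := Finset.card_le_two
    have hB3 : (alpha3 P).card ≤ 3 := Finset.card_le_three
    have := Nat.mul_le_mul_left I.card hB3
    have := Nat.mul_le_mul_left (3 ^ l - I.card) hA2
    rw [pow_succ] at h2
    omega
  · refine (hP.distortion_mixedSet_le I hA hB).trans_eq ?_
    rw [optError_high h1.le h2.le, hP.distortion_alpha2, hP.distortion_alpha3, hI,
      Nat.cast_sub h1.le, pow_succ]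
    push_cast
    ring

end TriadicCantor

theorem theorem3 (P : MeasureTheory.Measure ℝ) [MeasureTheory.IsProbabilityMeasure P]
    (hP : IsSelfSimilar P) :
    MeasureTheory.Integrable (fun x : ℝ => x ^ 2) P ∧
    ProbabilityTheory.variance (fun x : ℝ => x) P = 1 / 9 ∧
    distortion P (alpha2 P) = 821 / 28125 ∧
    distortion P (alpha3 P) = 1 / 225 ∧
    ∀ n l : ℕ, 3 ≤ n → 3 ^ l ≤ n → n < 3 ^ (l + 1) →
      ∀ I : Finset (Fin l → Fin 3),
        (n ≤ 2 * 3 ^ l → I.card = n - 3 ^ l) →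
        (2 * 3 ^ l < n → I.card = n - 2 * 3 ^ l) →
        IsOptimal P n (alphaSet P l n I) ∧
        quantError P n = distortion P (alphaSet P l n I) ∧
        (n ≤ 2 * 3 ^ l →
          distortion P (alphaSet P l n I) =
            1 / 75 ^ l *
              ((2 * 3 ^ l - (n : ℝ)) * ProbabilityTheory.variance (fun x : ℝ => x) P +
                ((n : ℝ) - 3 ^ l) * distortion P (alpha2 P))) ∧
        (2 * 3 ^ l < n →
          distortion P (alphaSet P l n I) =
            1 / 75 ^ l *
              ((3 ^ (l + 1) - (n : ℝ)) * distortion P (alpha2 P) +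
                ((n : ℝ) - 2 * 3 ^ l) * distortion P (alpha3 P))) := by
  refine ⟨hP.integrable (by fun_prop), hP.variance_eq, hP.distortion_alpha2,
    hP.distortion_alpha3, fun n l _ h1 h2 I hlow hhigh => ?_⟩
  rw [hP.variance_eq, hP.distortion_alpha2, hP.distortion_alpha3]
  rcases Nat.lt_or_ge (2 * 3 ^ l) n with h | h
  · obtain ⟨hopt, hD⟩ := hP.isOptimal_high h h2 (hhigh h)
    exact ⟨hopt, hopt.2.2.symm, fun h' => absurd h (not_lt.2 h'),
      fun _ => hD.trans (optError_high h.le h2.le)⟩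
  · obtain ⟨hopt, hD⟩ := hP.isOptimal_low h1 h (hlow h)
    exact ⟨hopt, hopt.2.2.symm, fun _ => hD.trans (optError_low h1 h),
      fun h' => absurd h' (not_lt.2 h)⟩
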